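/- For a set $E$ and $\mathcal T\subseteq\mathcal P(E)$ let $\mathcal T^\perp=\{v\subseteq E\mid \forall u\in\mathcal T,\ u\cap v\neq\emptyset\}$ and let $\mathord\uparrow\mathcal T$ be the set of all subsets of $E$ that contain an element of $\mathcal T$. A non-uniform totality space (NUTS) is a pair $X=(|X|,\mathcal T X)$ of a set $|X|$ (the web) and $\mathcal T X\subseteq\mathcal P(|X|)$ (the total sets) with $\mathcal T X=(\mathcal T X)^{\perp\perp}$. Put * $X^\perp=(|X|,(\mathcal TX)^\perp)$, $1=\bot=(\{*\},\{\{*\}\})$, $\top=(\emptyset,\{\emptyset\})$, $0=(\emptyset,\emptyset)$; * $X\otimes Y$: web $|X|\times|Y|$, total sets $\mathord\uparrow\{u\times v\mid u\in\mathcal TX,\ v\in\mathcal TY\}$; $X\multimap Y=(X\otimes Y^\perp)^\perp$; * $X\mathbin{\&}Y$: web the disjoint union $|X|+|Y|$, where $w$ is total iff its traces on $|X|$ and on $|Y|$ are total; $X\oplus Y=(X^\perp\mathbin{\&}Y^\perp)^\perp$; * $!X$: web the set of finite multisets of elements of $|X|$, total sets $\mathord\uparrow\{\mathcal M_{\mathrm{fin}}(u)\mid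 u\in\mathcal TX\}$. Let $\mathbf{NUTS}$ be the category of NUTS with $\mathbf{NUTS}(X,Y)=\mathcal T(X\multimap Y)$, relational composition and diagonal relations as identities. A Seely category is a symmetric monoidal closed category, $*$-autonomous with respect to a chosen dualizing object, with chosen finite products $(\&,\top)$, a comonad $(!,\mathrm{der},\mathrm{dig})$ and a strong symmetric monoidal structure $m^0:1\cong\,!\top$, $m^2_{X,Y}:\,!X\otimes!Y\cong\,!(X\mathbin\&Y)$ on the functor $!$, from $(\&,\top)$ to $(\otimes,1)$, such that $!\langle!\pi_1,!\pi_2\rangle\circ\mathrm{dig}_{X\&Y}\circ m^2_{X,Y}=m^2_{!X,!Y}\circ(\mathrm{dig}_X\otimes\mathrm{dig}_Y)$. **Claim.** $\mathbf{NUTS}$ is a Seely category with the following structure: the tensor product $\otimes$, with $t\otimes t'=\{((a,a'),(b,b'))\mid(a,b)\in t,(a',b')\in t'\}$, the unit $1$, and the associativity, unit and symmetry isomorphisms given by the evident bijections; the internal hom $\multimap$ with the evaluation that relates $a$ and $(a,b)$ to $b$; the dualizing object $\bot=1$; the products $\&$, $\top$ with projections $\{((1,a),a)\}$ and $\{((2,b),b)\}$;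 and the exponential with $$!t=\{([a_1,\dots,a_n],[b_1,\dots,b_n])\mid \forall i\ (a_i,b_i)\in t\},\quad \mathrm{der}_X=\{([a],a)\mid a\in|X|\},\quad \mathrm{dig}_X=\{(m_1+\dots+m_n,[m_1,\dots,m_n])\},$$ $$m^0=\{(*,[\,])\},\qquad m^2_{X,Y}=\{(([a_1,\dots,a_k],[b_1,\dots,b_l]),[(1,a_1),\dots,(1,a_k),(2,b_1),\dots,(2,b_l)])\}.$$ Moreover: 1. $!$ is a symmetric monoidal comonad on $(\mathbf{NUTS},\otimes,1)$: with $\mu^0=\,!((m^0)^{-1})\circ\mathrm{dig}_\top\circ m^0:1\to\,!1$ and $\mu^2_{X,Y}=\,!(\mathrm{der}_X\otimes\mathrm{der}_Y)\circ\,!((m^2_{X,Y})^{-1})\circ\mathrm{dig}_{X\& Y}\circ m^2_{X,Y}:\,!X\otimes!Y\to\,!(X\otimes Y)$, $!$ is a lax symmetric monoidal functor and $\mathrm{der}$, $\mathrm{dig}$ are monoidal natural transformations. 2. $a\mapsto(a,*)$ is an isomorphism $X^\perp\cong(X\multimap\bot)$, natural in $X$, where $(\_)^\perp$ sends a morphism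 to the converse relation. 3. $0=\top^\perp$ is initial, and $X\oplus Y$, whose total sets are the subsets $w$ of $|X|+|Y|$ whose trace on $|X|$ contains a total set of $X$ or whose trace on $|Y|$ contains a total set of $Y$, is the coproduct of $X$ and $Y$, with the evident injections. -/

import Mathlib

open CategoryTheory MonoidalCategory

universe v u

/-! ### Seely categories -/

section SeelyCategories

variable {C : Type u} [Category.{v} C] [MonoidalCategory C] [SymmetricCategory C]

/-- In a symmetric monoidal closed category, the canonical morphism
`X ⟶ (X ⊸ bot) ⊸ bot`, the curried form of the evaluation `X ⊗ (X ⊸ bot) ⟶ bot`. -/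
def toBidual [MonoidalClosed C] (bot X : C) :
    X ⟶ (ihom ((ihom X).obj bot)).obj bot :=
  MonoidalClosed.curry ((β_ ((ihom X).obj bot) X).hom ≫ (ihom.ev X).app bot)

/-- Strong symmetric monoidal structures on an endofunctor `F`, from the symmetric monoidal
category `(C, &, ⊤)` given by the chosen finite products `P`, to the ambient symmetric monoidal
category `(C, ⊗, 𝟙_)`. -/
abbrev StrongFromProducts (P : CartesianMonoidalCategory C) (F : C ⥤ C) :=
  @Functor.Braided C _ P.toMonoidalCategory
    (@BraidedCategory.ofCartesianMonoidalCategory C _ P) C _ _ _ F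

/-- The isomorphism `𝟙_ ≅ F ⊤` of a strong monoidal structure from products to tensors. -/
abbrev StrongFromProducts.unitIso {P : CartesianMonoidalCategory C} {F : C ⥤ C}
    (m : StrongFromProducts P F) : 𝟙_ C ≅ F.obj P.tensorUnit :=
  @Functor.Monoidal.εIso C _ P.toMonoidalCategory C _ _ F m.toMonoidal

/-- The isomorphism `F X ⊗ F Y ≅ F (X & Y)` of a strong monoidal structure from products to
tensors. -/
abbrev StrongFromProducts.mulIso {P : CartesianMonoidalCategory C} {F : C ⥤ C}
    (m : StrongFromProducts P F) (X Y : C) : F.obj X ⊗ F.obj Y ≅ F.obj (P.tensorObj X Y) :=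
  @Functor.Monoidal.μIso C _ P.toMonoidalCategory C _ _ F m.toMonoidal X Y

/-- A comonad `T`, together with `e : 𝟙_ ⟶ T 𝟙_` and `m : T X ⊗ T Y ⟶ T (X ⊗ Y)`, is a (lax)
symmetric monoidal comonad: `e` and `m` make `T` a lax symmetric monoidal functor, and the counit
and the comultiplication are monoidal natural transformations. -/
def IsSymmetricMonoidalComonad (T : Comonad C) (e : 𝟙_ C ⟶ T.obj (𝟙_ C))
    (m : ∀ X Y : C, T.obj X ⊗ T.obj Y ⟶ T.obj (X ⊗ Y)) : Prop :=
  ∃ _ : T.toFunctor.LaxBraided,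
    Functor.LaxMonoidal.ε T.toFunctor = e ∧
    (∀ X Y : C, Functor.LaxMonoidal.μ T.toFunctor X Y = m X Y) ∧
    NatTrans.IsMonoidal T.ε ∧ NatTrans.IsMonoidal T.δ

end SeelyCategories

/-- A structure of Seely category (a Seely model of classical linear logic) on a category `C`. -/
structure SeelyCategory (C : Type u) [Category.{v} C] where
  /-- The tensor product `⊗` with its unit, associator and unitors. -/
  [monoidal : MonoidalCategory C]
  /-- The symmetry of `⊗`. -/
  [symmetric : SymmetricCategory C]
  /-- Internal homs `X ⊸ Y = (ihom X).obj Y`. -/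
  [closed : MonoidalClosed C]
  /-- The dualizing object. -/
  bot : C
  /-- `C` is `*`-autonomous with dualizing object `bot`. -/
  starAutonomous : ∀ X : C, IsIso (toBidual bot X)
  /-- Chosen finite products: the product `X & Y` is `cart.tensorObj X Y`, and the final object
  is `cart.tensorUnit`. -/
  cart : CartesianMonoidalCategory C
  /-- The exponential comonad `!`, with dereliction `excl.ε` and digging `excl.δ`. -/
  excl : Comonad C
  /-- The Seely isomorphisms: a strong symmetric monoidal structure on the functor `!`, from
  `(C, &)` to `(C, ⊗)`. -/
  seely : StrongFromProducts cart excl.toFunctor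
  /-- Compatibility of the Seely isomorphisms with digging:
  `m_{X,Y} ≫ δ_{X & Y} ≫ !⟨!π₁, !π₂⟩ = (δ_X ⊗ δ_Y) ≫ m_{!X,!Y}`. -/
  seely_digging : ∀ X Y : C,
    (seely.mulIso X Y).hom ≫ excl.δ.app (cart.tensorObj X Y) ≫
      excl.map (@CartesianMonoidalCategory.lift C _ cart _ _ _
        (excl.map (cart.fst X Y)) (excl.map (cart.snd X Y))) =
    (excl.δ.app X ⊗ₘ excl.δ.app Y) ≫ (seely.mulIso (excl.obj X) (excl.obj Y)).hom

section Lax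

variable {C : Type u} [Category.{v} C] (S : SeelyCategory C)

/-- The morphism `1 ⟶ !⊤ ⟶ !!⊤ ⟶ !1` given by Seely, digging, and inverse Seely. -/
def SeelyCategory.laxUnit :
    letI := S.monoidal
    𝟙_ C ⟶ S.excl.obj (𝟙_ C) :=
  letI := S.monoidal
  letI := S.symmetric
  S.seely.unitIso.hom ≫ S.excl.δ.app S.cart.tensorUnit ≫ S.excl.map S.seely.unitIso.inv

/-- The morphism `!X ⊗ !Y ⟶ !(X & Y) ⟶ !!(X & Y) ⟶ !(!X ⊗ !Y) ⟶ !(X ⊗ Y)` given by Seely,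
digging, inverse Seely, and derelictions. -/
def SeelyCategory.laxMul (X Y : C) :
    letI := S.monoidal
    S.excl.obj X ⊗ S.excl.obj Y ⟶ S.excl.obj (X ⊗ Y) :=
  letI := S.monoidal
  letI := S.symmetric
  (S.seely.mulIso X Y).hom ≫ S.excl.δ.app (S.cart.tensorObj X Y) ≫
    S.excl.map (S.seely.mulIso X Y).inv ≫ S.excl.map (S.excl.ε.app X ⊗ₘ S.excl.ε.app Y)

/-- The comonad `!` of a Seely category is a symmetric monoidal comonad on `(C, ⊗)`, with the
lax monoidal structure derived from the Seely isomorphisms. -/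
def SeelyCategory.ExclIsSymmetricMonoidal : Prop :=
  letI := S.monoidal
  letI := S.symmetric
  IsSymmetricMonoidalComonad S.excl S.laxUnit S.laxMul

end Lax

/-! ### Non-uniform totality spaces -/

/-- `T^⊥`: the subsets which meet all elements of `T`. -/
def orthSet {E : Type u} (T : Set (Set E)) : Set (Set E) :=
  {v | ∀ w ∈ T, (w ∩ v).Nonempty}

/-- The upward closure of a set of subsets. -/
def upClosure {E : Type u} (T : Set (Set E)) : Set (Set E) :=
  {v | ∃ w ∈ T, w ⊆ v}

theorem biorth_eq_upClosure {E : Type u} (T : Set (Set E)) :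
    orthSet (orthSet T) = upClosure T := by
  ext v
  constructor
  · intro hv
    by_contra hn
    have hc : vᶜ ∈ orthSet T := by
      intro w hw
      by_contra he
      refine hn ⟨w, hw, fun a ha => ?_⟩
      by_contra hav
      exact he ⟨a, ha, hav⟩
    obtain ⟨a, ha, hb⟩ := hv _ hc
    exact ha hb
  · rintro ⟨w, hw, hwv⟩ v₁ hv₁
    obtain ⟨a, ha, hb⟩ := hv₁ w hw
    exact ⟨a, hb, hwv ha⟩

theorem biorth_eq_of_upward {E : Type u} {T : Set (Set E)}
    (h : ∀ w ∈ T, ∀ v, w ⊆ v → v ∈ T) : orthSet (orthSet T) = T := by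
  rw [biorth_eq_upClosure]
  ext v
  exact ⟨fun ⟨w, hw, hwv⟩ => h w hw v hwv, fun hv => ⟨v, hv, subset_rfl⟩⟩

theorem upward_orthSet {E : Type u} {T : Set (Set E)} :
    ∀ w ∈ orthSet T, ∀ v, w ⊆ v → v ∈ orthSet T :=
  fun _ hw _ hwv x hx => (hw x hx).mono (Set.inter_subset_inter_right x hwv)

theorem upward_upClosure {E : Type u} {T : Set (Set E)} :
    ∀ w ∈ upClosure T, ∀ v, w ⊆ v → v ∈ upClosure T :=
  fun _ ⟨x, hx, hxw⟩ _ hwv => ⟨x, hx, hxw.trans hwv⟩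

/-- A non-uniform totality space: a set (the web) with a set of subsets of the web (the total
subsets) which is equal to its biorthogonal. -/
structure NUTS : Type (u + 1) where
  web : Type u
  total : Set (Set web)
  biorth : orthSet (orthSet total) = total

namespace NUTS

theorem upward (X : NUTS.{u}) {w v : Set X.web} (hw : w ∈ X.total) (h : w ⊆ v) :
    v ∈ X.total := by
  have hx := hw
  rw [← X.biorth] at hx ⊢
  exact upward_orthSet w hx v h

/-- The dual `X^⊥`. -/
abbrev dual (X : NUTS.{u}) : NUTS.{u} where
  web := X.web
  total := orthSet X.total
  biorth := biorth_eq_of_upward upward_orthSet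

/-- The unit `1 = ⊥ = ({*}, {{*}})`. -/
abbrev one : NUTS.{u} where
  web := PUnit
  total := {Set.univ}
  biorth := biorth_eq_of_upward fun w hw v h => by
    rw [Set.mem_singleton_iff] at hw ⊢
    exact Set.univ_subset_iff.1 (hw ▸ h)

/-- The final object `⊤ = (∅, {∅})`. -/
abbrev top : NUTS.{u} where
  web := PEmpty
  total := {∅}
  biorth := biorth_eq_of_upward fun _ _ v _ => Set.mem_singleton_iff.2 v.eq_empty_of_isEmpty

/-- The initial object `0 = (∅, ∅)`. -/
abbrev zero : NUTS.{u} where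
  web := PEmpty
  total := ∅
  biorth := biorth_eq_of_upward fun _ hw => hw.elim

/-- The tensor product. -/
abbrev tens (X Y : NUTS.{u}) : NUTS.{u} where
  web := X.web × Y.web
  total := upClosure {w | ∃ x ∈ X.total, ∃ y ∈ Y.total, w = x ×ˢ y}
  biorth := biorth_eq_of_upward upward_upClosure

/-- Linear implication `X ⊸ Y = (X ⊗ Y^⊥)^⊥`. -/
abbrev limpl (X Y : NUTS.{u}) : NUTS.{u} := dual (tens X (dual Y))

/-- The product `X & Y`: a set is total when its two projections are. -/
abbrev prod (X Y : NUTS.{u}) : NUTS.{u} where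
  web := X.web ⊕ Y.web
  total := {w | Sum.inl ⁻¹' w ∈ X.total ∧ Sum.inr ⁻¹' w ∈ Y.total}
  biorth := biorth_eq_of_upward fun _ hw _ h =>
    ⟨X.upward hw.1 (Set.preimage_mono h), Y.upward hw.2 (Set.preimage_mono h)⟩

/-- The coproduct `X ⊕ Y = (X^⊥ & Y^⊥)^⊥`. -/
abbrev plus (X Y : NUTS.{u}) : NUTS.{u} := dual (prod (dual X) (dual Y))

/-- `M_fin(w)`: the finite multisets of elements of `w`. -/
def mfin {E : Type u} (w : Set E) : Set (Multiset E) := {m | ∀ a ∈ m, a ∈ w}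

/-- The exponential `!X`. -/
abbrev excl (X : NUTS.{u}) : NUTS.{u} where
  web := Multiset X.web
  total := upClosure {p | ∃ w ∈ X.total, p = mfin w}
  biorth := biorth_eq_of_upward upward_upClosure

/-- A set `t ⊆ |X| × |Y|` is total in `X ⊸ Y` iff it maps total sets to total sets. -/
theorem mem_limpl_iff {X Y : NUTS.{u}} {t : SetRel X.web Y.web} :
    t ∈ (limpl X Y).total ↔ ∀ w ∈ X.total, t.image w ∈ Y.total := by
  constructor
  · intro ht w hw
    rw [← Y.biorth]
    intro z hz
    obtain ⟨⟨a, b⟩, ⟨ha, hb⟩, hab⟩ := ht (w ×ˢ z) ⟨_, ⟨w, hw, z, hz, rfl⟩, subset_rfl⟩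
    exact ⟨b, hb, a, ha, hab⟩
  · rintro ht p ⟨q, ⟨w, hw, z, hz, rfl⟩, hq⟩
    obtain ⟨b, ⟨a, ha, hab⟩, hb⟩ := hz _ (ht w hw)
    exact ⟨(a, b), hq ⟨ha, hb⟩, hab⟩

/-- Morphisms `X ⟶ Y` are the total subsets of `X ⊸ Y`. -/
@[ext]
structure Hom (X Y : NUTS.{u}) : Type u where
  rel : SetRel X.web Y.web
  total : rel ∈ (limpl X Y).total

/-- The category of non-uniform totality spaces, with composition of relations and diagonal
relations as identities. -/
instance : LargeCategory NUTS.{u} where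
  Hom := Hom
  id X := ⟨SetRel.id, mem_limpl_iff.2 fun w hw => by rwa [SetRel.image_id]⟩
  comp f g := ⟨f.rel.comp g.rel, mem_limpl_iff.2 fun w hw => by
    rw [SetRel.image_comp]
    exact mem_limpl_iff.1 g.total _ (mem_limpl_iff.1 f.total w hw)⟩
  id_comp f := Hom.ext (SetRel.id_comp f.rel)
  comp_id f := Hom.ext (SetRel.comp_id f.rel)
  assoc f g h := Hom.ext (SetRel.comp_assoc f.rel g.rel h.rel)

/-! ### The relational constructions -/

section Relations

variable {E F G E₁ F₁ : Type u}

/-- Tensor product of relations. -/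
def tensRel (s : SetRel E F) (t : SetRel E₁ F₁) : SetRel (E × E₁) (F × F₁) :=
  {p | (p.1.1, p.2.1) ∈ s ∧ (p.1.2, p.2.2) ∈ t}

/-- The graph of a map, as a relation. -/
def graphRel (f : E → F) : SetRel E F := {p | f p.1 = p.2}

/-- Evaluation: `{((a, (a, b)), b)}`. -/
def evRel (E F : Type u) : SetRel (E × (E × F)) F :=
  {p | ∃ a b, p = ((a, (a, b)), b)}

/-- First projection `{((1, a), a)}`. -/
def fstRel (E F : Type u) : SetRel (E ⊕ F) E := {p | p.1 = Sum.inl p.2}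

/-- Second projection `{((2, b), b)}`. -/
def sndRel (E F : Type u) : SetRel (E ⊕ F) F := {p | p.1 = Sum.inr p.2}

/-- `!s = {([a₁, …, aₙ], [b₁, …, bₙ]) | ∀ i, (aᵢ, bᵢ) ∈ s}`. -/
def exclRel (s : SetRel E F) : SetRel (Multiset E) (Multiset F) :=
  {p | ∃ q : Multiset (E × F), (∀ c ∈ q, c ∈ s) ∧ p = (q.map Prod.fst, q.map Prod.snd)}

/-- Dereliction `{([a], a)}`. -/
def derRel (E : Type u) : SetRel (Multiset E) E := {p | ∃ a, p = ({a}, a)}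

/-- Digging `{(m₁ + ⋯ + mₙ, [m₁, …, mₙ])}`. -/
def diggRel (E : Type u) : SetRel (Multiset E) (Multiset (Multiset E)) :=
  {p | ∃ M : Multiset (Multiset E), p = (M.sum, M)}

/-- The nullary Seely isomorphism `{(*, [])}`. -/
def seelyUnitRel : SetRel PUnit.{u + 1} (Multiset PEmpty.{u + 1}) := {(PUnit.unit, 0)}

/-- The binary Seely isomorphism
`{(([a₁, …, aₖ], [b₁, …, bₗ]), [(1, a₁), …, (1, aₖ), (2, b₁), …, (2, bₗ)])}`. -/
def seelyMulRel (E F : Type u) : SetRel (Multiset E × Multiset F) (Multiset (E ⊕ F)) :=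
  {p | ∃ m n, p = ((m, n), m.map Sum.inl + n.map Sum.inr)}

end Relations

/-- `f` is the morphism from `X₁` to `Y₁` whose underlying relation is `r`; in particular `r` is a
morphism from `X₁` to `Y₁`. Here `X₁` and `Y₁` are equal to the source and the target of `f`,
though not necessarily by definition. -/
def IsRel {X Y : NUTS.{u}} (f : X ⟶ Y) (X₁ Y₁ : NUTS.{u}) (r : SetRel X₁.web Y₁.web) : Prop :=
  ∃ g : X₁ ⟶ Y₁, g.rel = r ∧ Arrow.mk f = Arrow.mk g

section Standard

variable (S : SeelyCategory NUTS.{u})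

/-- The symmetric monoidal closed structure and the dualizing object of `S` are the standard ones
on `NUTS`. -/
structure StandardMultiplicatives : Prop where
  tensorUnit : S.monoidal.tensorUnit = one
  tensorHom : ∀ {X Y X₁ Y₁ : NUTS.{u}} (f : X ⟶ Y) (g : X₁ ⟶ Y₁),
    IsRel (S.monoidal.tensorHom f g) (tens X X₁) (tens Y Y₁) (tensRel f.rel g.rel)
  associator : ∀ X Y Z, IsRel (S.monoidal.associator X Y Z).hom
    (tens (tens X Y) Z) (tens X (tens Y Z)) (graphRel fun p => (p.1.1, p.1.2, p.2))
  leftUnitor : ∀ X, IsRel (S.monoidal.leftUnitor X).hom (tens one X) X (graphRel Prod.snd)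
  rightUnitor : ∀ X, IsRel (S.monoidal.rightUnitor X).hom (tens X one) X (graphRel Prod.fst)
  braiding : ∀ X Y, IsRel (S.symmetric.braiding X Y).hom (tens X Y) (tens Y X) (graphRel Prod.swap)
  ihom_obj : ∀ X Y, letI := S.monoidal; letI := S.closed; (ihom X).obj Y = limpl X Y
  ev : ∀ X Y, letI := S.monoidal; letI := S.closed
    IsRel ((ihom.ev X).app Y) (tens X (limpl X Y)) Y (evRel X.web Y.web)
  bot : S.bot = one

/-- The finite products of `S` are the standard ones on `NUTS`. -/
structure StandardProducts : Prop where
  top : S.cart.tensorUnit = NUTS.top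
  fst : ∀ X Y, IsRel (S.cart.fst X Y) (prod X Y) X (fstRel X.web Y.web)
  snd : ∀ X Y, IsRel (S.cart.snd X Y) (prod X Y) Y (sndRel X.web Y.web)

/-- The exponential comonad of `S` and its Seely isomorphisms are the relational ones. -/
structure StandardExponential : Prop where
  obj : ∀ X, S.excl.obj X = excl X
  map : ∀ {X Y : NUTS.{u}} (f : X ⟶ Y), IsRel (S.excl.map f) (excl X) (excl Y) (exclRel f.rel)
  der : ∀ X, IsRel (S.excl.ε.app X) (excl X) X (derRel X.web)
  digg : ∀ X, IsRel (S.excl.δ.app X) (excl X) (excl (excl X)) (diggRel X.web)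
  seelyUnit : letI := S.monoidal; letI := S.symmetric
    IsRel S.seely.unitIso.hom one (excl NUTS.top) seelyUnitRel
  seelyMul : ∀ X Y, letI := S.monoidal; letI := S.symmetric
    IsRel (S.seely.mulIso X Y).hom (tens (excl X) (excl Y)) (excl (prod X Y))
      (seelyMulRel X.web Y.web)

/-- The contravariant functor `X ↦ X ⊸ bot` of `S` is, up to the natural isomorphism
`a ↦ (a, *)`, given by the orthogonal on objects and by the converse of relations on morphisms. -/
def StandardDuality : Prop :=
  letI := S.monoidal
  letI := S.closed
  ∃ e : ∀ X : NUTS.{u}, dual X ≅ (ihom X).obj S.bot,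
    (∀ X, IsRel (e X).hom (dual X) (limpl X one) (graphRel fun a => (a, PUnit.unit))) ∧
    ∀ {X Y : NUTS.{u}} (f : X ⟶ Y), ∃ g : dual Y ⟶ dual X, g.rel = f.rel.inv ∧
      g ≫ (e X).hom = (e Y).hom ≫ (MonoidalClosed.pre f).app S.bot

end Standard

end NUTS

namespace NUTS

/-! ### Morphisms and relations -/

/-! Morphisms are relations, composed as relations, so the functor forgetting totality is faithful.
Every equation required of a Seely category is thus an equation between relations, and two tasks
remain: proving these equations and checking that each structural relation is total.

Totality is easy because a biorthogonal is an upward closure: a relation is total in `X ⊸ Y` iff its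
direct image preserves total sets (`mem_limpl_iff`). When the source is a tensor product or an
exponential, it suffices to test the generators `x × y` or `M_fin(x)` (`mem_limpl_tens_iff`,
`mem_limpl_excl_iff`). A bijection of webs is an isomorphism once it is total in both directions.
For `X → X^⊥⊥` the backward direction is exactly the axiom that total sets equal their biorthogonal.

For the equations, the structural relations other than evaluation are graphs of functions or
converses of such graphs. Both classes are closed under composition, tensor and `!`, so a coherence
diagram becomes an identity between functions, sometimes read backwards. Dereliction and digging are
the converses of the unit and multiplication of the finite multiset monad, the Seely map is the
bijection `disjSumEquiv`, and the derived lax structure is the converse of `unzip`. Only naturality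
involves arbitrary relations; for `!` it follows by induction on multisets, mainly through
`cons_mem_exclRel_iff`. -/

theorem hom_ext {X Y : NUTS.{u}} {f g : X ⟶ Y}
    (h : ∀ a b, (a, b) ∈ f.rel ↔ (a, b) ∈ g.rel) : f = g :=
  Hom.ext (Set.ext fun p => h p.1 p.2)

@[simp]
theorem mem_comp_rel {X Y Z : NUTS.{u}} (f : X ⟶ Y) (g : Y ⟶ Z) (a : X.web) (c : Z.web) :
    (a, c) ∈ (f ≫ g).rel ↔ ∃ b, (a, b) ∈ f.rel ∧ (b, c) ∈ g.rel :=
  Iff.rfl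

@[simp]
theorem mem_id_rel {X : NUTS.{u}} (a b : X.web) : (a, b) ∈ Hom.rel (𝟙 X) ↔ a = b :=
  Iff.rfl

/-! ### Graphs, tensor products and currying of relations. -/

section Relations

variable {E F G E₁ F₁ G₁ E₂ F₂ : Type u}

@[simp]
theorem mem_graphRel (f : E → F) (a : E) (b : F) : (a, b) ∈ graphRel f ↔ f a = b :=
  Iff.rfl

theorem id_eq_graphRel : (SetRel.id : SetRel E E) = graphRel id :=
  rfl

theorem graphRel_comp_graphRel (f : E → F) (g : F → G) :
    (graphRel f).comp (graphRel g) = graphRel (g ∘ f) := by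
  ext ⟨a, b⟩
  simp

@[simp]
theorem mem_tensRel (s : SetRel E F) (t : SetRel E₁ F₁) (p : E × E₁) (q : F × F₁) :
    (p, q) ∈ tensRel s t ↔ (p.1, q.1) ∈ s ∧ (p.2, q.2) ∈ t :=
  Iff.rfl

theorem tensRel_graphRel (f : E → F) (g : E₁ → F₁) :
    tensRel (graphRel f) (graphRel g) = graphRel (Prod.map f g) := by
  ext ⟨⟨a, b⟩, c, d⟩
  simp

theorem tensRel_id_id : tensRel (SetRel.id : SetRel E E) (SetRel.id : SetRel F F) = SetRel.id :=
  tensRel_graphRel id id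

theorem tensRel_comp (s : SetRel E F) (t : SetRel E₁ F₁) (s' : SetRel F G) (t' : SetRel F₁ G₁) :
    (tensRel s t).comp (tensRel s' t') = tensRel (s.comp s') (t.comp t') := by
  ext ⟨⟨a, b⟩, c, d⟩
  simp only [SetRel.mem_comp, mem_tensRel, Prod.exists]
  tauto

theorem tensRel_assoc (r : SetRel E F) (s : SetRel E₁ F₁) (t : SetRel E₂ F₂) :
    (tensRel (tensRel r s) t).comp (graphRel (Equiv.prodAssoc F F₁ F₂)) =
      (graphRel (Equiv.prodAssoc E E₁ E₂)).comp (tensRel r (tensRel s t)) := by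
  ext ⟨⟨⟨a, b⟩, c⟩, a', b', c'⟩
  simp [and_assoc]

theorem tensRel_swap (s : SetRel E F) (t : SetRel E₁ F₁) :
    (tensRel s t).comp (graphRel Prod.swap) = (graphRel Prod.swap).comp (tensRel t s) := by
  ext ⟨⟨a, b⟩, a', b'⟩
  simp [and_comm]

theorem tensRel_fst (s : SetRel E F) :
    (tensRel s (SetRel.id : SetRel PUnit.{u + 1} _)).comp (graphRel Prod.fst) =
      (graphRel Prod.fst).comp s := by
  ext ⟨⟨a, b⟩, a'⟩
  simp

theorem tensRel_snd (s : SetRel E F) :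
    (tensRel (SetRel.id : SetRel PUnit.{u + 1} _) s).comp (graphRel Prod.snd) =
      (graphRel Prod.snd).comp s := by
  ext ⟨⟨a, b⟩, a'⟩
  simp

@[simp]
theorem mem_evRel (p : E × E × F) (b : F) : (p, b) ∈ evRel E F ↔ p.2 = (p.1, b) := by
  rcases p with ⟨a, c⟩
  simp [evRel, Prod.ext_iff]

/-- Currying of relations. -/
def lamRel (s : SetRel (E × F) G) : SetRel F (E × G) := {p | ((p.2.1, p.1), p.2.2) ∈ s}

/-- Uncurrying of relations. -/
def unlamRel (s : SetRel F (E × G)) : SetRel (E × F) G := {p | (p.1.2, (p.1.1, p.2)) ∈ s}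

@[simp]
theorem mem_lamRel (s : SetRel (E × F) G) (b : F) (p : E × G) :
    (b, p) ∈ lamRel s ↔ ((p.1, b), p.2) ∈ s :=
  Iff.rfl

@[simp]
theorem mem_unlamRel (s : SetRel F (E × G)) (p : E × F) (c : G) :
    (p, c) ∈ unlamRel s ↔ (p.2, (p.1, c)) ∈ s :=
  Iff.rfl

/-- Exhibits the action of `X ⊸ -` as the currying of evaluation followed by a morphism, from which
`limplMap` inherits its totality. -/
theorem lamRel_evRel_comp (s : SetRel F G) :
    lamRel ((evRel E F).comp s) = tensRel SetRel.id s := by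
  ext ⟨⟨a, b⟩, c, d⟩
  simp [and_assoc]

theorem unlamRel_comp (s : SetRel F G) (t : SetRel G (E × E₁)) :
    unlamRel (s.comp t) = (tensRel SetRel.id s).comp (unlamRel t) := by
  ext ⟨⟨a, b⟩, c⟩
  simp

theorem lamRel_comp (s : SetRel (E × F) G) (t : SetRel G G₁) :
    lamRel (s.comp t) = (lamRel s).comp (tensRel SetRel.id t) := by
  ext ⟨a, b, c⟩
  simp

theorem unlamRel_id : unlamRel (SetRel.id : SetRel (E × F) _) = evRel E F := by
  ext ⟨⟨a, b⟩, c⟩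
  simp

end Relations

theorem tens_total_of_prod {X Y : NUTS.{u}} {x : Set X.web} {y : Set Y.web} (hx : x ∈ X.total)
    (hy : y ∈ Y.total) {w : Set (X.web × Y.web)} (h : x ×ˢ y ⊆ w) : w ∈ (tens X Y).total :=
  ⟨_, ⟨x, hx, y, hy, rfl⟩, h⟩

/-- Direct images are monotone and total sets are upward closed, so generators of the total sets of
the source suffice; likewise for `mem_limpl_excl_iff`. -/
theorem mem_limpl_tens_iff {X Y Z : NUTS.{u}} {t : SetRel (X.web × Y.web) Z.web} :
    t ∈ (limpl (tens X Y) Z).total ↔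
      ∀ x ∈ X.total, ∀ y ∈ Y.total, t.image (x ×ˢ y) ∈ Z.total := by
  rw [mem_limpl_iff]
  constructor
  · intro h x hx y hy
    exact h _ (tens_total_of_prod hx hy subset_rfl)
  · rintro h w ⟨_, ⟨x, hx, y, hy, rfl⟩, hw⟩
    exact Z.upward (h x hx y hy) (SetRel.image_subset_image hw)

theorem mem_limpl_excl_iff {X Y : NUTS.{u}} {t : SetRel (Multiset X.web) Y.web} :
    t ∈ (limpl (excl X) Y).total ↔ ∀ x ∈ X.total, t.image (mfin x) ∈ Y.total := by
  rw [mem_limpl_iff]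
  constructor
  · intro h x hx
    exact h _ ⟨_, ⟨x, hx, rfl⟩, subset_rfl⟩
  · rintro h w ⟨_, ⟨x, hx, rfl⟩, hw⟩
    exact Y.upward (h x hx) (SetRel.image_subset_image hw)

/-- The isomorphism given by a bijection of webs which preserves total sets in both directions. -/
@[simps]
def isoOfEquiv {X Y : NUTS.{u}} (e : X.web ≃ Y.web)
    (h : graphRel e ∈ (limpl X Y).total) (h' : graphRel e.symm ∈ (limpl Y X).total) :
    X ≅ Y where
  hom := ⟨graphRel e, h⟩
  inv := ⟨graphRel e.symm, h'⟩
  hom_inv_id := hom_ext fun a b => by simp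
  inv_hom_id := hom_ext fun a b => by simp

/-! ### Finite products and finite coproducts -/

section Sums

variable {E F G E₁ F₁ G₁ E₂ F₂ : Type u}

/-- The sum of two relations. -/
def sumRel (s : SetRel E F) (t : SetRel E₁ F₁) : SetRel (E ⊕ E₁) (F ⊕ F₁) :=
  {p | Sum.LiftRel (fun a b => (a, b) ∈ s) (fun a b => (a, b) ∈ t) p.1 p.2}

@[simp]
theorem mem_sumRel (s : SetRel E F) (t : SetRel E₁ F₁) (p : E ⊕ E₁) (q : F ⊕ F₁) :
    (p, q) ∈ sumRel s t ↔
      Sum.LiftRel (fun a b => (a, b) ∈ s) (fun a b => (a, b) ∈ t) p q :=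
  Iff.rfl

theorem sumRel_graphRel (f : E → F) (g : E₁ → F₁) :
    sumRel (graphRel f) (graphRel g) = graphRel (Sum.map f g) := by
  ext ⟨a | a, b | b⟩ <;> simp

theorem sumRel_id_id : sumRel (SetRel.id : SetRel E E) (SetRel.id : SetRel F F) = SetRel.id := by
  ext ⟨a | a, b | b⟩ <;> simp

theorem sumRel_comp (s : SetRel E F) (t : SetRel E₁ F₁) (s' : SetRel F G) (t' : SetRel F₁ G₁) :
    (sumRel s t).comp (sumRel s' t') = sumRel (s.comp s') (t.comp t') := by
  ext ⟨a | a, b | b⟩ <;> simp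

theorem sumRel_assoc (r : SetRel E F) (s : SetRel E₁ F₁) (t : SetRel E₂ F₂) :
    (sumRel (sumRel r s) t).comp (graphRel (Equiv.sumAssoc F F₁ F₂)) =
      (graphRel (Equiv.sumAssoc E E₁ E₂)).comp (sumRel r (sumRel s t)) := by
  ext ⟨(a | a) | a, b | b | b⟩ <;> simp

theorem sumRel_empty_left (s : SetRel E F) :
    (sumRel (SetRel.id : SetRel PEmpty.{u + 1} _) s).comp (graphRel (Equiv.emptySum _ F)) =
      (graphRel (Equiv.emptySum _ E)).comp s := by
  ext ⟨a | a, b⟩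
  · exact a.elim
  · simp

theorem sumRel_empty_right (s : SetRel E F) :
    (sumRel s (SetRel.id : SetRel PEmpty.{u + 1} _)).comp (graphRel (Equiv.sumEmpty F _)) =
      (graphRel (Equiv.sumEmpty E _)).comp s := by
  ext ⟨a | a, b⟩
  · simp
  · exact a.elim

/-- The pairing of two relations with the same source. -/
def pairRel (s : SetRel G E) (t : SetRel G F) : SetRel G (E ⊕ F) :=
  {p | Sum.elim (fun a => (p.1, a) ∈ s) (fun b => (p.1, b) ∈ t) p.2}

@[simp]
theorem mem_pairRel (s : SetRel G E) (t : SetRel G F) (c : G) (p : E ⊕ F) :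
    (c, p) ∈ pairRel s t ↔ Sum.elim (fun a => (c, a) ∈ s) (fun b => (c, b) ∈ t) p :=
  Iff.rfl

theorem fstRel_eq : fstRel E F = (graphRel Sum.inl).inv := by
  ext ⟨a, b⟩
  exact eq_comm

theorem sndRel_eq : sndRel E F = (graphRel Sum.inr).inv := by
  ext ⟨a, b⟩
  exact eq_comm

theorem pairRel_comp_fstRel (s : SetRel G E) (t : SetRel G F) :
    (pairRel s t).comp (fstRel E F) = s := by
  ext ⟨c, a⟩
  simp [fstRel_eq]

theorem pairRel_comp_sndRel (s : SetRel G E) (t : SetRel G F) :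
    (pairRel s t).comp (sndRel E F) = t := by
  ext ⟨c, a⟩
  simp [sndRel_eq]

theorem eq_pairRel (r : SetRel G (E ⊕ F)) :
    r = pairRel (r.comp (fstRel E F)) (r.comp (sndRel E F)) := by
  ext ⟨c, a | a⟩ <;> simp [fstRel_eq, sndRel_eq]

/-- Reversing arrows turns pairing into the copairing of functions; this keeps pairings inside the
calculus of converses. -/
theorem pairRel_inv_graphRel (f : E → G) (g : F → G) :
    pairRel (graphRel f).inv (graphRel g).inv = (graphRel (Sum.elim f g)).inv := by
  ext ⟨c, a | a⟩ <;> simp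

theorem pairRel_snd_fst : pairRel (sndRel E F) (fstRel E F) = graphRel Sum.swap := by
  ext ⟨c | c, a | a⟩ <;> simp [fstRel_eq, sndRel_eq, eq_comm]

/-- The copairing of two relations with the same target. -/
def copairRel (s : SetRel E G) (t : SetRel F G) : SetRel (E ⊕ F) G :=
  {p | Sum.elim (fun a => (a, p.2) ∈ s) (fun b => (b, p.2) ∈ t) p.1}

@[simp]
theorem mem_copairRel (s : SetRel E G) (t : SetRel F G) (p : E ⊕ F) (c : G) :
    (p, c) ∈ copairRel s t ↔ Sum.elim (fun a => (a, c) ∈ s) (fun b => (b, c) ∈ t) p :=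
  Iff.rfl

theorem inl_comp_copairRel (s : SetRel E G) (t : SetRel F G) :
    (graphRel (Sum.inl : E → E ⊕ F)).comp (copairRel s t) = s := by
  ext ⟨a, c⟩
  simp

theorem inr_comp_copairRel (s : SetRel E G) (t : SetRel F G) :
    (graphRel (Sum.inr : F → E ⊕ F)).comp (copairRel s t) = t := by
  ext ⟨a, c⟩
  simp

theorem eq_copairRel (r : SetRel (E ⊕ F) G) :
    r = copairRel ((graphRel Sum.inl).comp r) ((graphRel Sum.inr).comp r) := by
  ext ⟨a | a, c⟩ <;> simp

end Sums

/-- The first projection. -/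
@[simps]
def prodFst (X Y : NUTS.{u}) : Hom (prod X Y) X where
  rel := fstRel X.web Y.web
  total := mem_limpl_iff.2 fun _ hw => X.upward hw.1 fun a ha => ⟨Sum.inl a, ha, rfl⟩

/-- The second projection. -/
@[simps]
def prodSnd (X Y : NUTS.{u}) : Hom (prod X Y) Y where
  rel := sndRel X.web Y.web
  total := mem_limpl_iff.2 fun _ hw => Y.upward hw.2 fun b hb => ⟨Sum.inr b, hb, rfl⟩

/-- The pairing of two morphisms. -/
@[simps]
def prodLift {X Y Z : NUTS.{u}} (f : Z ⟶ X) (g : Z ⟶ Y) : Hom Z (prod X Y) where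
  rel := pairRel f.rel g.rel
  total := mem_limpl_iff.2 fun z hz =>
    ⟨X.upward (mem_limpl_iff.1 f.total z hz) fun _ ⟨c, hc, h⟩ => ⟨c, hc, h⟩,
      Y.upward (mem_limpl_iff.1 g.total z hz) fun _ ⟨c, hc, h⟩ => ⟨c, hc, h⟩⟩

/-- The product of two morphisms. -/
@[simps]
def prodMap {X Y X₁ Y₁ : NUTS.{u}} (f : X ⟶ Y) (g : X₁ ⟶ Y₁) : Hom (prod X X₁) (prod Y Y₁) where
  rel := sumRel f.rel g.rel
  total := mem_limpl_iff.2 fun _ hw =>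
    ⟨Y.upward (mem_limpl_iff.1 f.total _ hw.1) fun _ ⟨a, ha, h⟩ =>
        ⟨Sum.inl a, ha, Sum.LiftRel.inl h⟩,
      Y₁.upward (mem_limpl_iff.1 g.total _ hw.2) fun _ ⟨a, ha, h⟩ =>
        ⟨Sum.inr a, ha, Sum.LiftRel.inr h⟩⟩

/-- The associativity isomorphism of products. -/
def prodAssoc (X Y Z : NUTS.{u}) : prod (prod X Y) Z ≅ prod X (prod Y Z) :=
  isoOfEquiv (Equiv.sumAssoc X.web Y.web Z.web)
    (mem_limpl_iff.2 fun _ hw =>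
      ⟨X.upward hw.1.1 fun a ha => ⟨Sum.inl (Sum.inl a), ha, rfl⟩,
        Y.upward hw.1.2 fun a ha => ⟨Sum.inl (Sum.inr a), ha, rfl⟩,
        Z.upward hw.2 fun a ha => ⟨Sum.inr a, ha, rfl⟩⟩)
    (mem_limpl_iff.2 fun _ hw =>
      ⟨⟨X.upward hw.1 fun a ha => ⟨Sum.inl a, ha, rfl⟩,
        Y.upward hw.2.1 fun a ha => ⟨Sum.inr (Sum.inl a), ha, rfl⟩⟩,
        Z.upward hw.2.2 fun a ha => ⟨Sum.inr (Sum.inr a), ha, rfl⟩⟩)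

/-- The left unit isomorphism of products. -/
def prodLeftUnit (X : NUTS.{u}) : prod top X ≅ X :=
  isoOfEquiv (Equiv.emptySum _ X.web)
    (mem_limpl_iff.2 fun _ hw => X.upward hw.2 fun a ha => ⟨Sum.inr a, ha, rfl⟩)
    (mem_limpl_iff.2 fun _ hw =>
      ⟨Set.eq_empty_of_isEmpty _, X.upward hw fun a ha => ⟨a, ha, rfl⟩⟩)

/-- The right unit isomorphism of products. -/
def prodRightUnit (X : NUTS.{u}) : prod X top ≅ X :=
  isoOfEquiv (Equiv.sumEmpty X.web _)
    (mem_limpl_iff.2 fun _ hw => X.upward hw.1 fun a ha => ⟨Sum.inl a, ha, rfl⟩)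
    (mem_limpl_iff.2 fun _ hw =>
      ⟨X.upward hw fun a ha => ⟨a, ha, rfl⟩, Set.eq_empty_of_isEmpty _⟩)

/-- The data of the monoidal structure given by the finite products. -/
abbrev prodMonoidalStruct : MonoidalCategoryStruct NUTS.{u} where
  tensorObj := prod
  tensorUnit := top
  tensorHom := prodMap
  whiskerLeft X _ _ f := prodMap (𝟙 X) f
  whiskerRight f X := prodMap f (𝟙 X)
  associator := prodAssoc
  leftUnitor := prodLeftUnit
  rightUnitor := prodRightUnit

/-- The monoidal structure given by the finite products. -/
abbrev prodMonoidal : MonoidalCategory NUTS.{u} :=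
  letI := prodMonoidalStruct.{u}
  MonoidalCategory.ofTensorHom
    (id_tensorHom_id := fun _ _ => Hom.ext sumRel_id_id)
    (tensorHom_comp_tensorHom := fun _ _ _ _ => Hom.ext (sumRel_comp _ _ _ _))
    (associator_naturality := fun _ _ _ => Hom.ext (sumRel_assoc _ _ _))
    (leftUnitor_naturality := fun f => Hom.ext (sumRel_empty_left f.rel))
    (rightUnitor_naturality := fun f => Hom.ext (sumRel_empty_right f.rel))
    (pentagon := fun W X Y Z => Hom.ext (by
      change ((sumRel (graphRel (Equiv.sumAssoc W.web X.web Y.web)) (graphRel id)).comp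
        ((graphRel (Equiv.sumAssoc W.web (X.web ⊕ Y.web) Z.web)).comp
        (sumRel (graphRel id) (graphRel (Equiv.sumAssoc X.web Y.web Z.web))))) =
        (graphRel (Equiv.sumAssoc (W.web ⊕ X.web) Y.web Z.web)).comp
        (graphRel (Equiv.sumAssoc W.web X.web (Y.web ⊕ Z.web)))
      -- Both sides become graphs of maps out of a fourfold sum, compared on each summand.
      simp only [sumRel_graphRel, graphRel_comp_graphRel]
      congr 1
      ext (((a | a) | a) | a) <;> rfl))
    (triangle := fun X Y => Hom.ext (by
      change (graphRel (Equiv.sumAssoc X.web PEmpty.{u + 1} Y.web)).comp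
        (sumRel (graphRel id) (graphRel (Equiv.emptySum _ Y.web))) =
        sumRel (graphRel (Equiv.sumEmpty X.web _)) (graphRel id)
      simp only [sumRel_graphRel, graphRel_comp_graphRel]
      congr 1
      ext ((a | a) | a)
      · rfl
      · exact a.elim
      · rfl))

/-- `⊤` is final. -/
def topIsTerminal : Limits.IsTerminal top.{u} :=
  Limits.IsTerminal.ofUniqueHom
    (fun X => (⟨∅, mem_limpl_iff.2 fun _ _ => Set.eq_empty_of_isEmpty _⟩ : Hom X top))
    fun _ _ => hom_ext fun _ b => b.elim

/-- `X & Y` is the product of `X` and `Y`. -/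
def prodIsLimit (X Y : NUTS.{u}) :
    Limits.IsLimit (Limits.BinaryFan.mk (P := prod X Y) (prodFst X Y) (prodSnd X Y)) :=
  Limits.BinaryFan.isLimitMk (fun s => prodLift s.fst s.snd)
    (fun _ => Hom.ext (pairRel_comp_fstRel _ _)) (fun _ => Hom.ext (pairRel_comp_sndRel _ _))
    fun _ m h₁ h₂ => Hom.ext ((eq_pairRel m.rel).trans
      (congrArg₂ pairRel (congrArg Hom.rel h₁) (congrArg Hom.rel h₂)))

/-- The chosen finite products. -/
abbrev cartesian : CartesianMonoidalCategory NUTS.{u} where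
  toMonoidalCategory := prodMonoidal
  isTerminalTensorUnit := topIsTerminal
  fst := prodFst
  snd := prodSnd
  fst_def X Y := Hom.ext (by
    -- The relation `∅` is the unique morphism from `Y` to `top`.
    change fstRel X.web Y.web = (sumRel (graphRel id) ∅).comp
      (graphRel (Equiv.sumEmpty X.web PEmpty.{u + 1}))
    ext ⟨a | a, b⟩ <;> simp [fstRel, eq_comm])
  snd_def X Y := Hom.ext (by
    change sndRel X.web Y.web = (sumRel ∅ (graphRel id)).comp
      (graphRel (Equiv.emptySum PEmpty.{u + 1} Y.web))
    ext ⟨a | a, b⟩ <;> simp [sndRel, eq_comm])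
  tensorProductIsBinaryProduct := prodIsLimit

/-- The braiding induced by finite products is the pairing of the second projection with the first.
-/
theorem cartesian_braiding_rel (X Y : NUTS.{u}) :
    Hom.rel (@BraidedCategory.braiding _ _ prodMonoidal
      (@BraidedCategory.ofCartesianMonoidalCategory _ _ cartesian) X Y).hom =
      graphRel Sum.swap :=
  pairRel_snd_fst

/-- `0` is initial. -/
def zeroIsInitial : Limits.IsInitial zero.{u} :=
  Limits.IsInitial.ofUniqueHom
    (fun X => (⟨∅, mem_limpl_iff.2 fun _ hw => hw.elim⟩ : Hom zero X))
    fun _ _ => hom_ext fun a => a.elim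

/-- No set meets `∅`, which is total in `top`; hence nothing is total in its dual. -/
theorem zero_eq_dual_top : zero.{u} = dual top := by
  have h : orthSet {(∅ : Set PEmpty.{u + 1})} = ∅ := by
    ext v
    simp [orthSet]
  simp only [zero, dual, top, h]

/-- If `v` contains no total set of either side, then the traces of its complement meet all total
sets of `X` and of `Y`. The complement is then total in `X^⊥ & Y^⊥`, so `v` would have to meet it.
-/
theorem plus_total (X Y : NUTS.{u}) :
    (plus X Y).total = {v | (∃ w ∈ X.total, Sum.inl '' w ⊆ v) ∨
      ∃ w ∈ Y.total, Sum.inr '' w ⊆ v} := by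
  ext v
  constructor
  · intro hv
    by_contra hn
    rw [Set.mem_ofPred_eq, not_or] at hn
    have hc : vᶜ ∈ (prod (dual X) (dual Y)).total := by
      constructor
      · intro w hw
        by_contra he
        refine hn.1 ⟨w, hw, ?_⟩
        rintro _ ⟨a, ha, rfl⟩
        by_contra hav
        exact he ⟨a, ha, hav⟩
      · intro w hw
        by_contra he
        refine hn.2 ⟨w, hw, ?_⟩
        rintro _ ⟨a, ha, rfl⟩
        by_contra hav
        exact he ⟨a, ha, hav⟩
    obtain ⟨a, ha, hb⟩ := hv _ hc
    exact ha hb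
  · rintro (⟨w, hw, h⟩ | ⟨w, hw, h⟩) z hz
    · obtain ⟨a, ha, hb⟩ := hz.1 w hw
      exact ⟨Sum.inl a, hb, h ⟨a, ha, rfl⟩⟩
    · obtain ⟨a, ha, hb⟩ := hz.2 w hw
      exact ⟨Sum.inr a, hb, h ⟨a, ha, rfl⟩⟩

/-- The first injection. -/
@[simps]
def plusInl (X Y : NUTS.{u}) : Hom X (plus X Y) where
  rel := graphRel Sum.inl
  total := mem_limpl_iff.2 fun w hw => by
    rw [plus_total]
    exact Or.inl ⟨w, hw, subset_rfl⟩

/-- The second injection. -/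
@[simps]
def plusInr (X Y : NUTS.{u}) : Hom Y (plus X Y) where
  rel := graphRel Sum.inr
  total := mem_limpl_iff.2 fun w hw => by
    rw [plus_total]
    exact Or.inr ⟨w, hw, subset_rfl⟩

/-- The copairing of two morphisms. -/
@[simps]
def plusDesc {X Y Z : NUTS.{u}} (f : X ⟶ Z) (g : Y ⟶ Z) : Hom (plus X Y) Z where
  rel := copairRel f.rel g.rel
  total := mem_limpl_iff.2 fun v hv => by
    rw [plus_total] at hv
    obtain ⟨w, hw, h⟩ | ⟨w, hw, h⟩ := hv
    · exact Z.upward (mem_limpl_iff.1 f.total w hw) fun _ ⟨a, ha, hc⟩ =>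
        ⟨Sum.inl a, h ⟨a, ha, rfl⟩, hc⟩
    · exact Z.upward (mem_limpl_iff.1 g.total w hw) fun _ ⟨a, ha, hc⟩ =>
        ⟨Sum.inr a, h ⟨a, ha, rfl⟩, hc⟩

/-- `X ⊕ Y` is the coproduct of `X` and `Y`. -/
def plusIsColimit (X Y : NUTS.{u}) :
    Limits.IsColimit (Limits.BinaryCofan.mk (P := plus X Y) (plusInl X Y) (plusInr X Y)) :=
  Limits.BinaryCofan.isColimitMk (fun s => plusDesc s.inl s.inr)
    (fun _ => Hom.ext (inl_comp_copairRel _ _)) (fun _ => Hom.ext (inr_comp_copairRel _ _))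
    fun _ m h₁ h₂ => Hom.ext ((eq_copairRel m.rel).trans
      (congrArg₂ copairRel (congrArg Hom.rel h₁) (congrArg Hom.rel h₂)))

/-! ### The symmetric monoidal closed structure -/

/-- The tensor product of morphisms. -/
@[simps]
def tensHom {X Y X₁ Y₁ : NUTS.{u}} (f : X ⟶ Y) (g : X₁ ⟶ Y₁) : tens X X₁ ⟶ tens Y Y₁ where
  rel := tensRel f.rel g.rel
  total := mem_limpl_tens_iff.2 fun x hx y hy => by
    refine tens_total_of_prod (mem_limpl_iff.1 f.total x hx) (mem_limpl_iff.1 g.total y hy) ?_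
    rintro ⟨a, b⟩ ⟨⟨a', ha, ha'⟩, ⟨b', hb, hb'⟩⟩
    exact ⟨(a', b'), ⟨ha, hb⟩, ha', hb'⟩

/-- The associativity isomorphism. -/
@[simps!]
def tensAssoc (X Y Z : NUTS.{u}) : tens (tens X Y) Z ≅ tens X (tens Y Z) :=
  isoOfEquiv (Equiv.prodAssoc X.web Y.web Z.web)
    (mem_limpl_tens_iff.2 (by
      rintro w ⟨_, ⟨x, hx, y, hy, rfl⟩, hw⟩ z hz
      refine tens_total_of_prod hx (tens_total_of_prod hy hz subset_rfl) ?_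
      rintro ⟨a, b, c⟩ ⟨ha, hb, hc⟩
      exact ⟨((a, b), c), ⟨hw ⟨ha, hb⟩, hc⟩, rfl⟩))
    (mem_limpl_tens_iff.2 (by
      rintro x hx w ⟨_, ⟨y, hy, z, hz, rfl⟩, hw⟩
      refine tens_total_of_prod (tens_total_of_prod hx hy subset_rfl) hz ?_
      rintro ⟨⟨a, b⟩, c⟩ ⟨⟨ha, hb⟩, hc⟩
      exact ⟨(a, b, c), ⟨ha, hw ⟨hb, hc⟩⟩, rfl⟩))

/-- The left unit isomorphism. -/
@[simps!]
def tensLeftUnit (X : NUTS.{u}) : tens one X ≅ X :=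
  isoOfEquiv (Equiv.punitProd X.web)
    (mem_limpl_tens_iff.2 (by
      rintro _ rfl x hx
      exact X.upward hx fun a ha => ⟨(PUnit.unit, a), ⟨trivial, ha⟩, rfl⟩))
    (mem_limpl_iff.2 fun x hx => tens_total_of_prod (X := one) rfl hx fun p hp =>
      ⟨p.2, hp.2, rfl⟩)

/-- The right unit isomorphism. -/
@[simps!]
def tensRightUnit (X : NUTS.{u}) : tens X one ≅ X :=
  isoOfEquiv (Equiv.prodPUnit X.web)
    (mem_limpl_tens_iff.2 (by
      rintro x hx _ rfl
      exact X.upward hx fun a ha => ⟨(a, PUnit.unit), ⟨ha, trivial⟩, rfl⟩))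
    (mem_limpl_iff.2 fun x hx => tens_total_of_prod (Y := one) hx rfl fun p hp =>
      ⟨p.1, hp.1, rfl⟩)

theorem graphRel_swap_mem (X Y : NUTS.{u}) :
    graphRel (Prod.swap : X.web × Y.web → _) ∈ (limpl (tens X Y) (tens Y X)).total :=
  mem_limpl_tens_iff.2 fun _ hx _ hy => tens_total_of_prod hy hx fun p hp =>
    ⟨p.swap, ⟨hp.2, hp.1⟩, rfl⟩

/-- The symmetry isomorphism. -/
@[simps!]
def tensSwap (X Y : NUTS.{u}) : tens X Y ≅ tens Y X :=
  isoOfEquiv (Equiv.prodComm X.web Y.web) (graphRel_swap_mem X Y) (graphRel_swap_mem Y X)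

instance : MonoidalCategoryStruct NUTS.{u} where
  tensorObj := tens
  tensorUnit := one
  tensorHom := tensHom
  whiskerLeft X _ _ f := tensHom (𝟙 X) f
  whiskerRight f X := tensHom f (𝟙 X)
  associator := tensAssoc
  leftUnitor := tensLeftUnit
  rightUnitor := tensRightUnit

instance : MonoidalCategory NUTS.{u} :=
  MonoidalCategory.ofTensorHom
    (id_tensorHom_id := fun _ _ => Hom.ext tensRel_id_id)
    (tensorHom_comp_tensorHom := fun _ _ _ _ => Hom.ext (tensRel_comp _ _ _ _))
    (associator_naturality := fun _ _ _ => Hom.ext (tensRel_assoc _ _ _))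
    (leftUnitor_naturality := fun f => Hom.ext (tensRel_snd f.rel))
    (rightUnitor_naturality := fun f => Hom.ext (tensRel_fst f.rel))
    (pentagon := fun W X Y Z => Hom.ext (by
      change ((tensRel (graphRel (Equiv.prodAssoc W.web X.web Y.web)) (graphRel id)).comp
        ((graphRel (Equiv.prodAssoc W.web (X.web × Y.web) Z.web)).comp
        (tensRel (graphRel id) (graphRel (Equiv.prodAssoc X.web Y.web Z.web))))) =
        (graphRel (Equiv.prodAssoc (W.web × X.web) Y.web Z.web)).comp
        (graphRel (Equiv.prodAssoc W.web X.web (Y.web × Z.web)))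
      -- What remains is an equality of two rearrangements of nested tuples, which holds by
      -- definition.
      simp only [tensRel_graphRel, graphRel_comp_graphRel]
      rfl))
    (triangle := fun X Y => Hom.ext (by
      change (graphRel (Equiv.prodAssoc X.web PUnit.{u + 1} Y.web)).comp
        (tensRel (graphRel id) (graphRel Prod.snd)) = tensRel (graphRel Prod.fst) (graphRel id)
      simp only [tensRel_graphRel, graphRel_comp_graphRel]
      rfl))

instance : SymmetricCategory NUTS.{u} where
  braiding := tensSwap
  braiding_naturality_right X _ _ f := Hom.ext (tensRel_swap SetRel.id f.rel)
  braiding_naturality_left f Z := Hom.ext (tensRel_swap f.rel SetRel.id)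
  hexagon_forward X Y Z := Hom.ext (by
    change (graphRel (Equiv.prodAssoc X.web Y.web Z.web)).comp ((graphRel Prod.swap).comp
      (graphRel (Equiv.prodAssoc Y.web Z.web X.web))) =
      (tensRel (graphRel Prod.swap) (graphRel id)).comp
        ((graphRel (Equiv.prodAssoc Y.web X.web Z.web)).comp
          (tensRel (graphRel id) (graphRel Prod.swap)))
    simp only [tensRel_graphRel, graphRel_comp_graphRel]
    rfl)
  hexagon_reverse X Y Z := Hom.ext (by
    change (graphRel (Equiv.prodAssoc X.web Y.web Z.web).symm).comp ((graphRel Prod.swap).comp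
      (graphRel (Equiv.prodAssoc Z.web X.web Y.web).symm)) =
      (tensRel (graphRel id) (graphRel Prod.swap)).comp
        ((graphRel (Equiv.prodAssoc X.web Z.web Y.web).symm).comp
          (tensRel (graphRel Prod.swap) (graphRel id)))
    simp only [tensRel_graphRel, graphRel_comp_graphRel]
    rfl)
  symmetry X Y := Hom.ext (graphRel_comp_graphRel Prod.swap Prod.swap)

/-- Evaluation. -/
@[simps]
def ev (X Y : NUTS.{u}) : Hom (tens X (limpl X Y)) Y where
  rel := evRel X.web Y.web
  total := mem_limpl_tens_iff.2 fun x hx _ ht =>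
    Y.upward (mem_limpl_iff.1 ht x hx) fun b ⟨a, ha, hab⟩ => ⟨(a, (a, b)), ⟨ha, hab⟩, a, b, rfl⟩

/-- Currying. -/
@[simps]
def lam {X Y Z : NUTS.{u}} (f : Hom (tens X Y) Z) : Hom Y (limpl X Z) where
  rel := lamRel f.rel
  total := mem_limpl_iff.2 fun y hy => mem_limpl_iff.2 fun x hx =>
    Z.upward (mem_limpl_tens_iff.1 f.total x hx y hy) fun _ ⟨p, hp, h⟩ =>
      ⟨p.1, hp.1, p.2, hp.2, h⟩

/-- Uncurrying. -/
@[simps]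
def unlam {X Y Z : NUTS.{u}} (g : Hom Y (limpl X Z)) : Hom (tens X Y) Z where
  rel := unlamRel g.rel
  total := mem_limpl_tens_iff.2 fun x hx y hy =>
    Z.upward (mem_limpl_iff.1 (mem_limpl_iff.1 g.total y hy) x hx)
      fun _ ⟨a, ha, b, hb, h⟩ => ⟨(a, b), ⟨ha, hb⟩, h⟩

/-- Functoriality of the internal hom in its second argument. -/
@[simps]
def limplMap (X : NUTS.{u}) {Y Z : NUTS.{u}} (f : Y ⟶ Z) : Hom (limpl X Y) (limpl X Z) where
  rel := tensRel SetRel.id f.rel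
  total := by
    rw [← lamRel_evRel_comp]
    exact (lam (ev X Y ≫ f : tens X (limpl X Y) ⟶ Z)).total

/-- The functor `X ⊸ -`. -/
def limplFunctor (X : NUTS.{u}) : NUTS.{u} ⥤ NUTS.{u} where
  obj := limpl X
  map f := limplMap X f
  map_id _ := Hom.ext tensRel_id_id
  map_comp f g := Hom.ext <| by
    -- The identity factor is split as a composite of two identities, so that the interchange law
    -- `tensRel_comp` applies.
    rw [limplMap_rel]
    exact (congrArg (tensRel · _) (SetRel.id_comp _).symm).trans
      (tensRel_comp SetRel.id f.rel SetRel.id g.rel).symm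

/-- The adjunction between `X ⊗ -` and `X ⊸ -`. -/
def limplAdj (X : NUTS.{u}) : tensorLeft X ⊣ limplFunctor X :=
  Adjunction.mkOfHomEquiv
    { homEquiv := fun _ _ =>
        { toFun := fun f => lam f
          invFun := fun f => unlam f
          left_inv := fun _ => rfl
          right_inv := fun _ => rfl }
      homEquiv_naturality_left_symm := fun f g => Hom.ext (unlamRel_comp f.rel g.rel)
      homEquiv_naturality_right := fun f g => Hom.ext (lamRel_comp f.rel g.rel) }

instance : MonoidalClosed NUTS.{u} where
  closed X := { rightAdj := limplFunctor X, adj := limplAdj X }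

/-- The counit of the adjunction is the uncurried identity. -/
theorem ihom_ev_app_rel (X Y : NUTS.{u}) : Hom.rel ((ihom.ev X).app Y) = evRel X.web Y.web :=
  unlamRel_id

theorem curry_rel {X Y Z : NUTS.{u}} (f : X ⊗ Y ⟶ Z) :
    Hom.rel (MonoidalClosed.curry f) = lamRel f.rel := by
  change Hom.rel ((limplAdj X).homEquiv Y Z f) = _
  rw [limplAdj, Adjunction.mkOfHomEquiv_homEquiv]
  rfl

/-! ### The exponential -/

section Multisets

variable {E F G E₁ F₁ E₂ F₂ : Type u}

/-- Trades the multiset of pairs for an inductive predicate, whose inversion rules for `cons` and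
`+` drive the inductions below. -/
theorem mem_exclRel (s : SetRel E F) (m : Multiset E) (n : Multiset F) :
    (m, n) ∈ exclRel s ↔ Multiset.Rel (fun a b => (a, b) ∈ s) m n := by
  constructor
  · rintro ⟨q, hq, h⟩
    cases h
    rw [Multiset.rel_map]
    exact Multiset.rel_refl_of_refl_on hq
  · intro h
    induction h with
    | zero => exact ⟨0, by simp, rfl⟩
    | @cons a b m n hab _ ih =>
      obtain ⟨q, hq, h⟩ := ih
      cases h
      refine ⟨(a, b) ::ₘ q, fun c hc => ?_, by simp⟩
      rcases Multiset.mem_cons.1 hc with rfl | hc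
      exacts [hab, hq c hc]

@[simp]
theorem zero_mem_exclRel_iff (s : SetRel E F) (m : Multiset E) :
    (m, 0) ∈ exclRel s ↔ m = 0 := by
  rw [mem_exclRel, Multiset.rel_zero_right]

theorem cons_mem_exclRel_iff (s : SetRel E F) (m : Multiset E) (b : F) (n : Multiset F) :
    (m, b ::ₘ n) ∈ exclRel s ↔ ∃ a m', (a, b) ∈ s ∧ (m', n) ∈ exclRel s ∧ m = a ::ₘ m' := by
  simp only [mem_exclRel, Multiset.rel_cons_right]

theorem add_mem_exclRel_iff (s : SetRel E F) (m : Multiset E) (n n' : Multiset F) :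
    (m, n + n') ∈ exclRel s ↔
      ∃ k k', (k, n) ∈ exclRel s ∧ (k', n') ∈ exclRel s ∧ m = k + k' := by
  simp only [mem_exclRel, Multiset.rel_add_right]

theorem exclRel_graphRel (f : E → F) : exclRel (graphRel f) = graphRel (Multiset.map f) := by
  ext ⟨m, n⟩
  simp only [mem_exclRel, mem_graphRel]
  rw [← Multiset.rel_eq, Multiset.rel_map_left]

theorem exclRel_inv (s : SetRel E F) : exclRel s.inv = (exclRel s).inv := by
  ext ⟨m, n⟩
  rw [SetRel.mem_inv, mem_exclRel, mem_exclRel, ← Multiset.rel_flip]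
  rfl

theorem exclRel_id : exclRel (SetRel.id : SetRel E E) = SetRel.id := by
  rw [id_eq_graphRel, exclRel_graphRel]
  exact congrArg graphRel (funext Multiset.map_id)

theorem exclRel_comp (s : SetRel E F) (t : SetRel F G) :
    exclRel (s.comp t) = (exclRel s).comp (exclRel t) := by
  ext ⟨m, k⟩
  induction k using Multiset.induction_on generalizing m with
  | empty => simp
  | cons c k ih =>
    simp only [SetRel.mem_comp, cons_mem_exclRel_iff] at ih ⊢
    constructor
    · rintro ⟨a, m', ⟨b, hab, hbc⟩, h, rfl⟩
      obtain ⟨n, hn, hk⟩ := (ih m').1 h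
      exact ⟨b ::ₘ n, (cons_mem_exclRel_iff _ _ _ _).2 ⟨a, m', hab, hn, rfl⟩, b, n, hbc, hk, rfl⟩
    · rintro ⟨_, h, b, n, hbc, hk, rfl⟩
      obtain ⟨a, m', hab, hn, rfl⟩ := (cons_mem_exclRel_iff _ _ _ _).1 h
      exact ⟨a, m', ⟨b, hab, hbc⟩, (ih m').2 ⟨n, hn, hk⟩, rfl⟩

/-- This is the totality of `!s`: choosing a preimage in `w` for each occurrence in `n` builds a
related multiset in `M_fin(w)`. -/
theorem mfin_image_subset (s : SetRel E F) (w : Set E) :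
    mfin (s.image w) ⊆ (exclRel s).image (mfin w) := by
  intro n hn
  induction n using Multiset.induction_on with
  | empty => exact ⟨0, fun a ha => absurd ha (Multiset.notMem_zero a), by simp⟩
  | cons b n ih =>
    obtain ⟨m, hm, h⟩ := ih fun c hc => hn c (Multiset.mem_cons_of_mem hc)
    obtain ⟨a, ha, hab⟩ := hn b (Multiset.mem_cons_self b n)
    refine ⟨a ::ₘ m, fun c hc => ?_, (cons_mem_exclRel_iff _ _ _ _).2 ⟨a, m, hab, h, rfl⟩⟩
    rcases Multiset.mem_cons.1 hc with rfl | hc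
    exacts [ha, hm c hc]

/-- With `diggRel_eq`, this presents dereliction and digging as converses of the unit and
multiplication of the multiset monad; the comonad laws are the monad laws reversed. -/
theorem derRel_eq : derRel E = (graphRel fun a : E => ({a} : Multiset E)).inv := by
  ext ⟨m, a⟩
  simp [derRel, eq_comm]

theorem diggRel_eq : diggRel E = (graphRel Multiset.join).inv := by
  ext ⟨m, M⟩
  simp only [diggRel, SetRel.mem_inv, mem_graphRel]
  constructor
  · rintro ⟨_, h⟩
    cases h
    rfl
  · rintro rfl
    exact ⟨M, rfl⟩

/-! ### Calculus of converses of graphs. -/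

theorem inv_graphRel_comp (f : F → E) (g : G → F) :
    (graphRel f).inv.comp (graphRel g).inv = (graphRel (f ∘ g)).inv := by
  rw [← SetRel.inv_comp, graphRel_comp_graphRel]

theorem exclRel_inv_graphRel (f : E → F) :
    exclRel (graphRel f).inv = (graphRel (Multiset.map f)).inv := by
  rw [exclRel_inv, exclRel_graphRel]

theorem tensRel_inv_graphRel (f : E → F) (g : E₁ → F₁) :
    tensRel (graphRel f).inv (graphRel g).inv = (graphRel (Prod.map f g)).inv := by
  rw [← tensRel_graphRel]
  rfl

/-- Lets isomorphisms, given as graphs, enter the calculus of converses. -/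
theorem graphRel_equiv (e : E ≃ F) : graphRel e = (graphRel e.symm).inv := by
  ext ⟨a, b⟩
  exact e.eq_symm_apply.symm.trans eq_comm

theorem id_eq_inv_graphRel : (SetRel.id : SetRel E E) = (graphRel id).inv :=
  graphRel_equiv (Equiv.refl E)

theorem exclRel_comp_derRel (s : SetRel E F) :
    (exclRel s).comp (derRel F) = (derRel E).comp s := by
  ext ⟨m, b⟩
  simp only [derRel_eq, SetRel.mem_comp, SetRel.mem_inv, mem_graphRel, exists_eq_right']
  rw [← Multiset.cons_zero, cons_mem_exclRel_iff]
  simp [eq_comm, and_comm]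

/-- A multiset related to `n + N.join` splits into a part related to `n` and a part related to
`N.join`; induction on `N` regroups the parts. -/
theorem exclRel_comp_diggRel (s : SetRel E F) :
    (exclRel s).comp (diggRel F) = (diggRel E).comp (exclRel (exclRel s)) := by
  ext ⟨m, N⟩
  simp only [diggRel_eq, SetRel.mem_comp, SetRel.mem_inv, mem_graphRel, exists_eq_right']
  induction N using Multiset.induction_on generalizing m with
  | empty => simp [eq_comm]
  | cons n N ih =>
    rw [Multiset.join_cons, add_mem_exclRel_iff]
    simp only [cons_mem_exclRel_iff, ih]
    constructor
    · rintro ⟨k, _, hk, ⟨M, rfl, hM⟩, rfl⟩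
      exact ⟨k ::ₘ M, Multiset.join_cons _ _, k, M, hk, hM, rfl⟩
    · rintro ⟨_, rfl, k, M, hk, hM, rfl⟩
      exact ⟨k, M.join, hk, ⟨M, rfl, hM⟩, Multiset.join_cons _ _⟩

theorem join_map_singleton (m : Multiset E) : (m.map fun a => ({a} : Multiset E)).join = m :=
  Multiset.sum_map_singleton m

theorem diggRel_comp_derRel : (diggRel E).comp (derRel (Multiset E)) = SetRel.id := by
  rw [diggRel_eq, derRel_eq, inv_graphRel_comp, id_eq_inv_graphRel]
  congr 2
  funext m
  exact Multiset.singleton_join m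

theorem diggRel_comp_exclRel_derRel : (diggRel E).comp (exclRel (derRel E)) = SetRel.id := by
  rw [diggRel_eq, derRel_eq, exclRel_inv_graphRel, inv_graphRel_comp, id_eq_inv_graphRel]
  congr 2
  funext m
  exact join_map_singleton m

theorem diggRel_comp_exclRel_diggRel :
    (diggRel E).comp (exclRel (diggRel E)) = (diggRel E).comp (diggRel (Multiset E)) := by
  rw [diggRel_eq, diggRel_eq, exclRel_inv_graphRel, inv_graphRel_comp, inv_graphRel_comp]
  congr 2
  funext M
  -- Since `join` is a sum of multisets, its associativity is the formula for the product of a join,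
  -- in multiplicative notation.
  exact (Multiset.prod_join (α := Multiplicative (Multiset E)) (S := M)).symm

end Multisets

/-- The action of the exponential on morphisms. -/
@[simps]
def exclHom {X Y : NUTS.{u}} (f : X ⟶ Y) : Hom (excl X) (excl Y) where
  rel := exclRel f.rel
  total := mem_limpl_excl_iff.2 fun w hw =>
    ⟨_, ⟨_, mem_limpl_iff.1 f.total w hw, rfl⟩, mfin_image_subset f.rel w⟩

/-- Dereliction. -/
@[simps]
def der (X : NUTS.{u}) : Hom (excl X) X where
  rel := derRel X.web
  total := mem_limpl_excl_iff.2 fun _ hw => X.upward hw fun a ha =>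
    ⟨{a}, fun _ hb => Multiset.mem_singleton.1 hb ▸ ha, a, rfl⟩

/-- Digging. -/
@[simps]
def digg (X : NUTS.{u}) : Hom (excl X) (excl (excl X)) where
  rel := diggRel X.web
  total := mem_limpl_excl_iff.2 fun w hw =>
    -- The image contains the generator `M_fin(M_fin(w))`, because summing multisets over `w` stays
    -- in `M_fin(w)`.
    ⟨_, ⟨mfin w, ⟨_, ⟨w, hw, rfl⟩, subset_rfl⟩, rfl⟩, fun M hM => ⟨M.sum, fun a ha => by
      obtain ⟨m, hm, ham⟩ := Multiset.mem_join.1 ha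
      exact hM m hm a ham, M, rfl⟩⟩

/-- The exponential functor. -/
def exclFunctor : NUTS.{u} ⥤ NUTS.{u} where
  obj := excl
  map f := exclHom f
  map_id _ := Hom.ext exclRel_id
  map_comp _ _ := Hom.ext (exclRel_comp _ _)

/-- The exponential comonad. -/
def exclComonad : Comonad NUTS.{u} where
  toFunctor := exclFunctor
  ε :=
    { app := der
      naturality := fun _ _ f => Hom.ext (exclRel_comp_derRel f.rel) }
  δ :=
    { app := digg
      naturality := fun _ _ f => Hom.ext (exclRel_comp_diggRel f.rel) }
  coassoc _ := Hom.ext diggRel_comp_exclRel_diggRel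
  left_counit _ := Hom.ext diggRel_comp_derRel
  right_counit _ := Hom.ext diggRel_comp_exclRel_derRel

/-! ### The Seely isomorphisms -/

section Multisets

variable {E F G E₁ F₁ E₂ F₂ : Type u}

theorem filterMap_getLeft_inl_cons (a : E) (q : Multiset (E ⊕ F)) :
    (Sum.inl a ::ₘ q).filterMap Sum.getLeft? = a ::ₘ q.filterMap Sum.getLeft? :=
  Multiset.filterMap_cons_some _ _ q rfl

theorem filterMap_getLeft_inr_cons (b : F) (q : Multiset (E ⊕ F)) :
    (Sum.inr b ::ₘ q).filterMap Sum.getLeft? = q.filterMap Sum.getLeft? :=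
  Multiset.filterMap_cons_none _ q rfl

theorem filterMap_getRight_inl_cons (a : E) (q : Multiset (E ⊕ F)) :
    (Sum.inl a ::ₘ q).filterMap Sum.getRight? = q.filterMap Sum.getRight? :=
  Multiset.filterMap_cons_none _ q rfl

theorem filterMap_getRight_inr_cons (b : F) (q : Multiset (E ⊕ F)) :
    (Sum.inr b ::ₘ q).filterMap Sum.getRight? = b ::ₘ q.filterMap Sum.getRight? :=
  Multiset.filterMap_cons_some _ _ q rfl

/-- Pairs of multisets are multisets of elements of the disjoint union. -/
def disjSumEquiv (E F : Type u) : Multiset E × Multiset F ≃ Multiset (E ⊕ F) where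
  toFun p := p.1.map Sum.inl + p.2.map Sum.inr
  invFun q := (q.filterMap Sum.getLeft?, q.filterMap Sum.getRight?)
  left_inv p := by
    rcases p with ⟨m, n⟩
    induction m using Multiset.induction_on with
    | empty =>
      induction n using Multiset.induction_on with
      | empty => simp
      | cons b n ih =>
        simpa [filterMap_getLeft_inr_cons, filterMap_getRight_inr_cons] using ih
    | cons a m ih =>
      simp only [Prod.mk.injEq] at ih
      simp only [Multiset.map_cons, Multiset.cons_add, filterMap_getLeft_inl_cons,
        filterMap_getRight_inl_cons, ih]
  right_inv q := by
    induction q using Multiset.induction_on with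
    | empty => simp
    | cons c q ih =>
      rcases c with a | b
      · simpa [filterMap_getLeft_inl_cons, filterMap_getRight_inl_cons] using ih
      · simpa [filterMap_getLeft_inr_cons, filterMap_getRight_inr_cons] using ih

theorem disjSumEquiv_symm_inl_cons (a : E) (q : Multiset (E ⊕ F)) :
    (disjSumEquiv E F).symm (Sum.inl a ::ₘ q) =
      (a ::ₘ ((disjSumEquiv E F).symm q).1, ((disjSumEquiv E F).symm q).2) :=
  Prod.ext (filterMap_getLeft_inl_cons a q) (filterMap_getRight_inl_cons a q)

theorem disjSumEquiv_symm_inr_cons (b : F) (q : Multiset (E ⊕ F)) :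
    (disjSumEquiv E F).symm (Sum.inr b ::ₘ q) =
      (((disjSumEquiv E F).symm q).1, b ::ₘ ((disjSumEquiv E F).symm q).2) :=
  Prod.ext (filterMap_getLeft_inr_cons b q) (filterMap_getRight_inr_cons b q)

theorem disjSumEquiv_apply (p : Multiset E × Multiset F) :
    disjSumEquiv E F p = p.1.map Sum.inl + p.2.map Sum.inr :=
  rfl

theorem seelyMulRel_eq : seelyMulRel E F = graphRel (disjSumEquiv E F) := by
  ext ⟨⟨m, n⟩, p⟩
  constructor
  · rintro ⟨_, _, h⟩
    cases h
    rfl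
  · intro h
    cases (mem_graphRel _ _ _).1 h
    exact ⟨m, n, rfl⟩

theorem inl_mem_disjSumEquiv_iff (p : Multiset E × Multiset F) (a : E) :
    Sum.inl a ∈ disjSumEquiv E F p ↔ a ∈ p.1 := by
  simp [disjSumEquiv_apply]

theorem inr_mem_disjSumEquiv_iff (p : Multiset E × Multiset F) (b : F) :
    Sum.inr b ∈ disjSumEquiv E F p ↔ b ∈ p.2 := by
  simp [disjSumEquiv_apply]

/-- Naturality of the Seely map. A sum of relations never relates a left element to a right one, so
a matching of tagged multisets splits into its two sides. -/
theorem tensRel_exclRel_comp_disjSumEquiv (s : SetRel E F) (t : SetRel E₁ F₁) :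
    (tensRel (exclRel s) (exclRel t)).comp (graphRel (disjSumEquiv F F₁)) =
      (graphRel (disjSumEquiv E E₁)).comp (exclRel (sumRel s t)) := by
  ext ⟨⟨m, n⟩, q⟩
  obtain ⟨⟨m', n'⟩, rfl⟩ := (disjSumEquiv F F₁).surjective q
  simp only [SetRel.mem_comp, mem_graphRel, EmbeddingLike.apply_eq_iff_eq, exists_eq_right,
    exists_eq_left', mem_tensRel]
  -- Using the inverse bijection keeps `p` and `q` arbitrary, as induction on the matching requires.
  have h : ∀ (p : Multiset (E ⊕ E₁)) (q : Multiset (F ⊕ F₁)), (p, q) ∈ exclRel (sumRel s t) →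
      (((disjSumEquiv E E₁).symm p).1, ((disjSumEquiv F F₁).symm q).1) ∈ exclRel s ∧
      (((disjSumEquiv E E₁).symm p).2, ((disjSumEquiv F F₁).symm q).2) ∈ exclRel t := by
    intro p q h
    rw [mem_exclRel] at h
    induction h with
    | zero => simp [disjSumEquiv]
    | cons hab _ ih =>
      simp only [mem_exclRel] at ih ⊢
      rcases hab with ⟨hab⟩ | ⟨hab⟩
      · simp only [disjSumEquiv_symm_inl_cons]
        exact ⟨Multiset.Rel.cons hab ih.1, ih.2⟩
      · simp only [disjSumEquiv_symm_inr_cons]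
        exact ⟨ih.1, Multiset.Rel.cons hab ih.2⟩
  constructor
  · rintro ⟨h₁, h₂⟩
    rw [mem_exclRel] at h₁ h₂ ⊢
    refine Multiset.Rel.add ?_ ?_ <;> rw [Multiset.rel_map]
    · exact h₁.mono fun _ _ _ _ h => Sum.LiftRel.inl h
    · exact h₂.mono fun _ _ _ _ h => Sum.LiftRel.inr h
  · intro h₁
    simpa using h _ _ h₁

theorem map_sumAssoc_disjSumEquiv (m : Multiset E) (n : Multiset F) (k : Multiset G) :
    (disjSumEquiv (E ⊕ F) G (disjSumEquiv E F (m, n), k)).map (Equiv.sumAssoc E F G) =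
      disjSumEquiv E (F ⊕ G) (m, disjSumEquiv F G (n, k)) := by
  simp only [disjSumEquiv_apply, Multiset.map_add, Multiset.map_map, ← add_assoc]
  rfl

theorem map_swap_disjSumEquiv (p : Multiset E × Multiset F) :
    (disjSumEquiv E F p).map Sum.swap = disjSumEquiv F E p.swap := by
  simp only [disjSumEquiv_apply, Multiset.map_add, Multiset.map_map, Prod.fst_swap,
    Prod.snd_swap]
  exact add_comm _ _

theorem map_emptySum_disjSumEquiv (m : Multiset E) :
    (disjSumEquiv PEmpty.{u + 1} E (0, m)).map (Equiv.emptySum _ E) = m := by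
  simp only [disjSumEquiv_apply, Multiset.map_zero, zero_add, Multiset.map_map]
  exact Multiset.map_id m

theorem map_sumEmpty_disjSumEquiv (m : Multiset E) :
    (disjSumEquiv E PEmpty.{u + 1} (m, 0)).map (Equiv.sumEmpty E _) = m := by
  simp only [disjSumEquiv_apply, Multiset.map_zero, add_zero, Multiset.map_map]
  exact Multiset.map_id m

/-- There is a unique multiset of elements of the empty set. -/
def punitEquiv : PUnit.{u + 1} ≃ Multiset PEmpty.{u + 1} where
  toFun _ := 0
  invFun _ := PUnit.unit
  left_inv _ := rfl
  right_inv _ := (Multiset.eq_zero_of_forall_notMem fun a => a.elim).symm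

theorem seelyUnitRel_eq : seelyUnitRel.{u} = graphRel punitEquiv.{u} := by
  ext ⟨a, m⟩
  simp [seelyUnitRel, punitEquiv, eq_comm]

end Multisets

/-- The nullary Seely isomorphism. -/
def seelyUnit : one.{u} ≅ excl top :=
  isoOfEquiv punitEquiv
    (mem_limpl_iff.2 (by
      rintro _ rfl
      exact ⟨_, ⟨∅, rfl, rfl⟩, fun m _ =>
        ⟨PUnit.unit, trivial, punitEquiv.apply_symm_apply m⟩⟩))
    (mem_limpl_excl_iff.2 fun _ _ => Set.eq_univ_of_forall fun _ =>
      ⟨0, fun a _ => a.elim, rfl⟩)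

/-- The binary Seely isomorphism. -/
def seelyMul (X Y : NUTS.{u}) : tens (excl X) (excl Y) ≅ excl (prod X Y) :=
  isoOfEquiv (disjSumEquiv X.web Y.web)
    (mem_limpl_tens_iff.2 (by
      rintro u ⟨_, ⟨x, hx, rfl⟩, hu⟩ v ⟨_, ⟨y, hy, rfl⟩, hv⟩
      -- The generator is `M_fin` of the disjoint union of `x` and `y`.
      refine ⟨_, ⟨{c | Sum.elim (· ∈ x) (· ∈ y) c}, ⟨hx, hy⟩, rfl⟩, fun q hq => ?_⟩
      obtain ⟨p, rfl⟩ := (disjSumEquiv X.web Y.web).surjective q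
      exact ⟨p, ⟨hu fun a ha => hq _ ((inl_mem_disjSumEquiv_iff p a).2 ha),
        hv fun b hb => hq _ ((inr_mem_disjSumEquiv_iff p b).2 hb)⟩, rfl⟩))
    (mem_limpl_excl_iff.2 fun w hw =>
      tens_total_of_prod (X := excl X) (Y := excl Y) ⟨_, ⟨_, hw.1, rfl⟩, subset_rfl⟩
        ⟨_, ⟨_, hw.2, rfl⟩, subset_rfl⟩ fun p hp => by
        refine ⟨disjSumEquiv X.web Y.web p, ?_, Equiv.symm_apply_apply _ p⟩
        rintro (a | b) h
        · exact hp.1 a ((inl_mem_disjSumEquiv_iff p a).1 h)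
        · exact hp.2 b ((inr_mem_disjSumEquiv_iff p b).1 h))

/-- The Seely isomorphisms, as a strong monoidal structure on the exponential. -/
def seelyCoreMonoidal :
    @Functor.CoreMonoidal NUTS.{u} _ prodMonoidal NUTS.{u} _ _ exclFunctor :=
  @Functor.CoreMonoidal.mk NUTS.{u} _ prodMonoidal NUTS.{u} _ _ exclFunctor seelyUnit seelyMul
    (fun {X Y} f X' => Hom.ext (by
      -- The identity of `!X'` is `!` of an identity, so whiskering is a case of naturality in both
      -- variables.
      refine Eq.trans ?_ (tensRel_exclRel_comp_disjSumEquiv f.rel (SetRel.id : SetRel X'.web _))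
      rw [exclRel_id]
      rfl))
    (fun {X Y} X' f => Hom.ext (by
      refine Eq.trans ?_ (tensRel_exclRel_comp_disjSumEquiv (SetRel.id : SetRel X'.web _) f.rel)
      rw [exclRel_id]
      rfl))
    (fun X Y Z => Hom.ext (by
      change (tensRel (graphRel (disjSumEquiv X.web Y.web)) (graphRel id)).comp
        ((graphRel (disjSumEquiv (X.web ⊕ Y.web) Z.web)).comp
          (exclRel (graphRel (Equiv.sumAssoc X.web Y.web Z.web)))) =
        (graphRel (Equiv.prodAssoc _ _ _)).comp
          ((tensRel (graphRel id) (graphRel (disjSumEquiv Y.web Z.web))).comp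
            (graphRel (disjSumEquiv X.web (Y.web ⊕ Z.web))))
      simp only [tensRel_graphRel, exclRel_graphRel, graphRel_comp_graphRel]
      congr 1
      funext p
      exact map_sumAssoc_disjSumEquiv p.1.1 p.1.2 p.2))
    (fun X => Hom.ext (by
      change graphRel Prod.snd = (tensRel (graphRel punitEquiv) (graphRel id)).comp
        ((graphRel (disjSumEquiv PEmpty.{u + 1} X.web)).comp
          (exclRel (graphRel (Equiv.emptySum PEmpty.{u + 1} X.web))))
      simp only [tensRel_graphRel, exclRel_graphRel, graphRel_comp_graphRel]
      congr 1
      funext p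
      exact (map_emptySum_disjSumEquiv p.2).symm))
    (fun X => Hom.ext (by
      change graphRel Prod.fst = (tensRel (graphRel id) (graphRel punitEquiv)).comp
        ((graphRel (disjSumEquiv X.web PEmpty.{u + 1})).comp
          (exclRel (graphRel (Equiv.sumEmpty X.web PEmpty.{u + 1}))))
      simp only [tensRel_graphRel, exclRel_graphRel, graphRel_comp_graphRel]
      congr 1
      funext p
      exact (map_sumEmpty_disjSumEquiv p.1).symm))

/-- The Seely isomorphisms, as a strong symmetric monoidal structure on the exponential. -/
@[reducible]
def seelyStrong : StrongFromProducts cartesian.{u} exclComonad.{u}.toFunctor :=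
  @Functor.Braided.mk NUTS.{u} _ prodMonoidal
    (@BraidedCategory.ofCartesianMonoidalCategory NUTS.{u} _ cartesian) NUTS.{u} _ _ _ exclFunctor
    (@Functor.CoreMonoidal.toMonoidal _ _ prodMonoidal _ _ _ _ seelyCoreMonoidal)
    fun X Y => Hom.ext (by
      change (graphRel (disjSumEquiv X.web Y.web)).comp
        (exclRel (Hom.rel (@BraidedCategory.braiding _ _ prodMonoidal
          (@BraidedCategory.ofCartesianMonoidalCategory _ _ cartesian) X Y).hom)) =
        (graphRel Prod.swap).comp (graphRel (disjSumEquiv Y.web X.web))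
      rw [cartesian_braiding_rel, exclRel_graphRel, graphRel_comp_graphRel,
        graphRel_comp_graphRel]
      congr 1
      funext p
      exact map_swap_disjSumEquiv p)

/-- The digging axiom in terms of functions: tagging inside the inner multisets and then flattening
agrees with flattening each side and then tagging. -/
theorem join_map_elim_disjSumEquiv {E F : Type u}
    (p : Multiset (Multiset E) × Multiset (Multiset F)) :
    ((disjSumEquiv (Multiset E) (Multiset F) p).map
      (Sum.elim (Multiset.map Sum.inl) (Multiset.map Sum.inr))).join =
      disjSumEquiv E F (p.1.join, p.2.join) := by
  simp only [disjSumEquiv_apply, Multiset.map_add, Multiset.map_map, Multiset.join_add,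
    Multiset.map_join]
  rfl

theorem seelyMul_digg (X Y : NUTS.{u}) :
    (seelyMul X Y).hom ≫ exclComonad.δ.app (prod X Y) ≫
      exclComonad.map (prodLift (exclComonad.map (prodFst X Y : prod X Y ⟶ X))
        (exclComonad.map (prodSnd X Y : prod X Y ⟶ Y)) : excl (prod X Y) ⟶ _) =
    tensHom (exclComonad.δ.app X) (exclComonad.δ.app Y) ≫ (seelyMul (excl X) (excl Y)).hom :=
  Hom.ext (by
    change (graphRel (disjSumEquiv X.web Y.web)).comp ((diggRel (X.web ⊕ Y.web)).comp
      (exclRel (pairRel (exclRel (fstRel X.web Y.web)) (exclRel (sndRel X.web Y.web))))) =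
      (tensRel (diggRel X.web) (diggRel Y.web)).comp
        (graphRel (disjSumEquiv (Multiset X.web) (Multiset Y.web)))
    -- Every arrow is now the converse of a function, the Seely maps through their inverses.
    simp only [graphRel_equiv (disjSumEquiv _ _), diggRel_eq, fstRel_eq, sndRel_eq, exclRel_inv_graphRel,
      pairRel_inv_graphRel, inv_graphRel_comp, tensRel_inv_graphRel]
    congr 2
    funext q
    obtain ⟨p, rfl⟩ := (disjSumEquiv (Multiset X.web) (Multiset Y.web)).surjective q
    simp only [Function.comp_apply, join_map_elim_disjSumEquiv, Equiv.symm_apply_apply]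
    rfl)

/-! ### Duality -/

theorem lamRel_swap_comp_evRel (E : Type u) :
    lamRel ((graphRel Prod.swap).comp (evRel E PUnit.{u + 1})) =
      graphRel fun a => ((a, PUnit.unit), PUnit.unit) := by
  ext ⟨a, ⟨b, c⟩, d⟩
  simp [eq_comm]

theorem lamRel_tensRel_comp_evRel {E F : Type u} (s : SetRel E F) :
    s.inv.comp (graphRel fun a => (a, PUnit.unit)) =
      (graphRel fun b => (b, PUnit.unit)).comp
        (lamRel ((tensRel s SetRel.id).comp (evRel F PUnit.{u + 1}))) := by
  ext ⟨b, a, c⟩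
  simp

theorem toBidual_rel (X : NUTS.{u}) :
    Hom.rel (toBidual one X) = graphRel fun a => ((a, PUnit.unit), PUnit.unit) := by
  rw [toBidual, curry_rel]
  change lamRel ((graphRel Prod.swap).comp (Hom.rel ((ihom.ev X).app one))) = _
  rw [ihom_ev_app_rel]
  exact lamRel_swap_comp_evRel X.web

theorem isIso_toBidual (X : NUTS.{u}) : IsIso (toBidual one X) := by
  let e : X.web ≃ (X.web × PUnit.{u + 1}) × PUnit.{u + 1} :=
    ((Equiv.prodPUnit _).trans (Equiv.prodPUnit _)).symm
  have h : graphRel e ∈ (limpl X (limpl (limpl X one) one)).total := by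
    change graphRel (fun a => ((a, PUnit.unit), PUnit.unit)) ∈ _
    rw [← toBidual_rel]
    exact (toBidual one X).total
  have h' : graphRel e.symm ∈ (limpl (limpl (limpl X one) one) X).total := by
    refine mem_limpl_iff.2 fun w hw => ?_
    rw [← X.biorth]
    intro z hz
    -- Since `z` meets every total set of `X`, the relation `z × {*}` is total in `X ⊸ 1`; testing
    -- `w` against it produces a point of `z`, and biorthogonality concludes.
    have hz' : (Prod.fst ⁻¹' z : SetRel X.web PUnit.{u + 1}) ∈ (limpl X one).total :=
      mem_limpl_iff.2 fun x hx => Set.eq_univ_of_forall fun _ =>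
        let ⟨a, ha, ha'⟩ := hz x hx
        ⟨a, ha, ha'⟩
    have hu : PUnit.unit ∈ SetRel.image w (Prod.fst ⁻¹' z) :=
      (Set.mem_singleton_iff.1 (mem_limpl_iff.1 hw _ hz')).symm ▸ Set.mem_univ _
    obtain ⟨p, hp, hpw⟩ := hu
    exact ⟨p.1, hp, (p, PUnit.unit), hpw, rfl⟩
  have : toBidual one X = (isoOfEquiv e h h').hom := Hom.ext (toBidual_rel X)
  rw [this]
  infer_instance

/-- The isomorphism between `X^⊥` and `X ⊸ ⊥`. -/
def dualIso (X : NUTS.{u}) : dual X ≅ limpl X one :=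
  isoOfEquiv (Y := limpl X one) (Equiv.prodPUnit X.web).symm
    (mem_limpl_iff.2 fun z hz => mem_limpl_iff.2 fun x hx => Set.eq_univ_of_forall fun _ =>
      let ⟨a, ha, ha'⟩ := hz x hx
      ⟨a, ha, a, ha', rfl⟩)
    (mem_limpl_iff.2 fun t ht x hx => by
      have hu : PUnit.unit ∈ SetRel.image t x :=
        (Set.mem_singleton_iff.1 (mem_limpl_iff.1 ht x hx)).symm ▸ Set.mem_univ _
      obtain ⟨a, ha, hat⟩ := hu
      exact ⟨a, ha, (a, PUnit.unit), hat, rfl⟩)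

/-- The converse of a morphism. -/
@[simps]
def dualHom {X Y : NUTS.{u}} (f : X ⟶ Y) : Hom (dual Y) (dual X) where
  rel := f.rel.inv
  total := mem_limpl_iff.2 fun z hz x hx => by
    obtain ⟨b, ⟨a, ha, hab⟩, hb⟩ := hz _ (mem_limpl_iff.1 f.total x hx)
    exact ⟨a, ha, b, hb, hab⟩

theorem dualIso_natural {X Y : NUTS.{u}} (f : X ⟶ Y) :
    (dualHom f : dual Y ⟶ dual X) ≫ (dualIso X).hom =
      (dualIso Y).hom ≫ (MonoidalClosed.pre f).app one := by
  -- Expressing `pre` as a currying makes its relation accessible to `curry_rel`.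
  have h : (MonoidalClosed.pre f).app one =
      MonoidalClosed.curry (f ▷ (ihom Y).obj one ≫ (ihom.ev Y).app one) := by
    rw [← MonoidalClosed.uncurry_pre, MonoidalClosed.curry_uncurry]
  refine Hom.ext ((lamRel_tensRel_comp_evRel f.rel).trans ?_)
  rw [h]
  change _ = (graphRel fun b => (b, PUnit.unit)).comp
    (Hom.rel (MonoidalClosed.curry (f ▷ (ihom Y).obj one ≫ (ihom.ev Y).app one)))
  rw [curry_rel]
  change _ = (graphRel fun b => (b, PUnit.unit)).comp
    (lamRel ((tensRel f.rel SetRel.id).comp (Hom.rel ((ihom.ev Y).app one))))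
  rw [ihom_ev_app_rel]

/-- The Seely category of non-uniform totality spaces. -/
def seelyCategory : SeelyCategory NUTS.{u} where
  bot := one
  starAutonomous := isIso_toBidual
  cart := cartesian
  excl := exclComonad
  seely := seelyStrong
  seely_digging := seelyMul_digg

/-! ### The symmetric monoidal comonad -/

section Multisets

variable {E F G E₁ F₁ : Type u}

/-- The two projections of a multiset of pairs. -/
def unzip (p : Multiset (E × F)) : Multiset E × Multiset F :=
  (p.map Prod.fst, p.map Prod.snd)

/-- Each pair `(a, b)` contributes the two-element multiset `[(1, a), (2, b)]`; this is the content
of `laxMulRel_eq`. -/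
theorem disjSumEquiv_unzip (p : Multiset (E × F)) :
    disjSumEquiv E F (unzip p) =
      (p.map fun c => disjSumEquiv E F ({c.1}, {c.2})).join := by
  induction p using Multiset.induction_on with
  | empty => rfl
  | cons c p ih =>
    rw [Multiset.map_cons, Multiset.join_cons, ← ih]
    simp only [disjSumEquiv_apply, unzip, Multiset.map_cons, Multiset.map_singleton]
    simp only [← Multiset.singleton_add]
    abel

/-- The pairs in `q` dictate how to combine the two separate matchings: each picks one source on
either side, and these are paired. -/
theorem tensRel_exclRel_comp_unzip (s : SetRel E F) (t : SetRel E₁ F₁) :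
    (tensRel (exclRel s) (exclRel t)).comp (graphRel unzip).inv =
      (graphRel unzip).inv.comp (exclRel (tensRel s t)) := by
  ext ⟨⟨m, n⟩, q⟩
  simp only [SetRel.mem_comp, SetRel.mem_inv, mem_graphRel, exists_eq_right', mem_tensRel, unzip,
    Prod.mk.injEq]
  induction q using Multiset.induction_on generalizing m n with
  | empty => simp [eq_comm]
  | cons c q ih =>
    simp only [Multiset.map_cons, cons_mem_exclRel_iff]
    constructor
    · rintro ⟨⟨a, m', ha, hm, rfl⟩, b, n', hb, hn, rfl⟩
      obtain ⟨p, ⟨rfl, rfl⟩, hp⟩ := (ih m' n').1 ⟨hm, hn⟩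
      exact ⟨(a, b) ::ₘ p, by simp, (a, b), p, ⟨ha, hb⟩, hp, rfl⟩
    · rintro ⟨_, ⟨rfl, rfl⟩, a, p, ha, hp, rfl⟩
      obtain ⟨hm, hn⟩ := (ih _ _).2 ⟨p, ⟨rfl, rfl⟩, hp⟩
      exact ⟨⟨a.1, _, ha.1, hm, Multiset.map_cons _ _ _⟩, a.2, _, ha.2, hn,
        Multiset.map_cons _ _ _⟩

theorem unzip_join (P : Multiset (Multiset (E × F))) :
    unzip P.join = Prod.map Multiset.join Multiset.join (unzip (P.map unzip)) := by
  simp only [unzip, Multiset.map_join, Multiset.map_map, Prod.map_apply]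
  rfl

theorem exclRel_graphRel_symm (e : E ≃ F) :
    exclRel (graphRel e.symm) = (graphRel (Multiset.map e)).inv := by
  rw [graphRel_equiv, exclRel_inv_graphRel]
  rfl

theorem laxUnitRel_eq :
    (graphRel punitEquiv).comp ((diggRel PEmpty.{u + 1}).comp
      (exclRel (graphRel punitEquiv.symm))) = (graphRel fun _ => PUnit.unit).inv := by
  rw [exclRel_graphRel_symm, graphRel_equiv, diggRel_eq, inv_graphRel_comp, inv_graphRel_comp]

/-- The derived map relates `(m, n)` to all multisets of pairs with projections `m` and `n`; every
factor is the converse of a function. -/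
theorem laxMulRel_eq (E F : Type u) :
    (graphRel (disjSumEquiv E F)).comp ((diggRel (E ⊕ F)).comp
      ((exclRel (graphRel (disjSumEquiv E F).symm)).comp
        (exclRel (tensRel (derRel E) (derRel F))))) = (graphRel unzip).inv := by
  rw [exclRel_graphRel_symm, graphRel_equiv, diggRel_eq, derRel_eq, derRel_eq,
    tensRel_inv_graphRel, exclRel_inv_graphRel, inv_graphRel_comp, inv_graphRel_comp,
    inv_graphRel_comp]
  congr 2
  funext p
  rw [Function.comp_apply, Equiv.symm_apply_eq, disjSumEquiv_unzip, Function.comp_apply,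
    Function.comp_apply, Multiset.map_map]
  rfl

end Multisets

/-- The nullary part of the lax monoidal structure of the exponential. -/
@[simps]
def laxUnit : Hom one.{u} (excl one) where
  rel := (graphRel fun _ => PUnit.unit).inv
  total := by
    -- Totality comes from the composite of morphisms defining the derived unit; the same device
    -- serves for `laxMul`.
    rw [← laxUnitRel_eq]
    exact (seelyCategory.laxUnit : one ⟶ excl one).total

/-- The binary part of the lax monoidal structure of the exponential. -/
@[simps]
def laxMul (X Y : NUTS.{u}) : Hom (tens (excl X) (excl Y)) (excl (tens X Y)) where
  rel := (graphRel unzip).inv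
  total := by
    rw [← laxMulRel_eq]
    exact (seelyCategory.laxMul X Y : tens (excl X) (excl Y) ⟶ excl (tens X Y)).total

/-- The lax monoidal structure of the exponential. -/
@[reducible]
def exclLaxMonoidal : exclFunctor.{u}.LaxMonoidal where
  ε := laxUnit
  μ := laxMul
  μ_natural_left {X Y} f X' := Hom.ext (by
    refine Eq.trans ?_ (tensRel_exclRel_comp_unzip f.rel (SetRel.id : SetRel X'.web _))
    rw [exclRel_id]
    rfl)
  μ_natural_right {X Y} X' f := Hom.ext (by
    refine Eq.trans ?_ (tensRel_exclRel_comp_unzip (SetRel.id : SetRel X'.web _) f.rel)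
    rw [exclRel_id]
    rfl)
  associativity X Y Z := Hom.ext (by
    change (tensRel (graphRel unzip).inv SetRel.id).comp ((graphRel unzip).inv.comp
      (exclRel (graphRel (Equiv.prodAssoc X.web Y.web Z.web)))) =
      (graphRel (Equiv.prodAssoc (Multiset X.web) (Multiset Y.web) (Multiset Z.web))).comp
        ((tensRel SetRel.id (graphRel unzip).inv).comp (graphRel unzip).inv)
    simp only [graphRel_equiv (Equiv.prodAssoc _ _ _), id_eq_inv_graphRel,
      exclRel_inv_graphRel, tensRel_inv_graphRel, inv_graphRel_comp]
    congr 2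
    funext p
    simp [unzip, Multiset.map_map])
  left_unitality X := Hom.ext (by
    change graphRel (Equiv.punitProd (Multiset X.web)) =
      (tensRel (graphRel fun _ => PUnit.unit).inv SetRel.id).comp
        ((graphRel unzip).inv.comp (exclRel (graphRel (Equiv.punitProd X.web))))
    rw [graphRel_equiv (Equiv.punitProd (Multiset X.web)), graphRel_equiv (Equiv.punitProd X.web)]
    simp only [id_eq_inv_graphRel, exclRel_inv_graphRel, tensRel_inv_graphRel, inv_graphRel_comp]
    congr 2
    funext p
    simp [unzip, Multiset.map_map])
  right_unitality X := Hom.ext (by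
    change graphRel (Equiv.prodPUnit (Multiset X.web)) =
      (tensRel SetRel.id (graphRel fun _ => PUnit.unit).inv).comp
        ((graphRel unzip).inv.comp (exclRel (graphRel (Equiv.prodPUnit X.web))))
    rw [graphRel_equiv (Equiv.prodPUnit (Multiset X.web)), graphRel_equiv (Equiv.prodPUnit X.web)]
    simp only [id_eq_inv_graphRel, exclRel_inv_graphRel, tensRel_inv_graphRel, inv_graphRel_comp]
    congr 2
    funext p
    simp [unzip, Multiset.map_map])

/-- The lax symmetric monoidal structure of the exponential. -/
@[reducible]
def exclLaxBraided : exclFunctor.{u}.LaxBraided where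
  toLaxMonoidal := exclLaxMonoidal
  braided X Y := Hom.ext (by
    change (graphRel unzip).inv.comp (exclRel (graphRel (Equiv.prodComm X.web Y.web))) =
      (graphRel (Equiv.prodComm (Multiset X.web) (Multiset Y.web))).comp (graphRel unzip).inv
    simp only [graphRel_equiv (Equiv.prodComm _ _), exclRel_inv_graphRel, inv_graphRel_comp]
    congr 2
    funext p
    simp [unzip, Multiset.map_map])

theorem isMonoidal_der :
    letI := exclLaxMonoidal.{u}
    NatTrans.IsMonoidal (F₁ := exclFunctor.{u}) (F₂ := 𝟭 _) exclComonad.ε := by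
  refine @NatTrans.IsMonoidal.mk _ _ _ _ _ _ exclFunctor (𝟭 _) _ exclLaxMonoidal _ (Hom.ext ?_)
    fun X Y => Hom.ext ?_
  · change (graphRel fun _ => PUnit.unit).inv.comp (derRel PUnit.{u + 1}) = SetRel.id
    rw [derRel_eq, inv_graphRel_comp, id_eq_inv_graphRel]
    rfl
  · change (graphRel unzip).inv.comp (derRel (X.web × Y.web)) =
      (tensRel (derRel X.web) (derRel Y.web)).comp SetRel.id
    rw [derRel_eq, derRel_eq, derRel_eq, inv_graphRel_comp, tensRel_inv_graphRel,
      SetRel.comp_id]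
    rfl

theorem isMonoidal_digg :
    letI := exclLaxMonoidal.{u}
    NatTrans.IsMonoidal (F₁ := exclFunctor.{u}) (F₂ := exclFunctor ⋙ exclFunctor)
      exclComonad.δ := by
  let _ := exclLaxMonoidal.{u}
  refine @NatTrans.IsMonoidal.mk _ _ _ _ _ _ exclFunctor (exclFunctor ⋙ exclFunctor) _ _ _
    (Hom.ext ?_) fun X Y => Hom.ext ?_
  · change (graphRel fun _ => PUnit.unit).inv.comp (diggRel PUnit.{u + 1}) =
      (graphRel fun _ => PUnit.unit).inv.comp (exclRel (graphRel fun _ => PUnit.unit).inv)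
    rw [diggRel_eq, exclRel_inv_graphRel, inv_graphRel_comp, inv_graphRel_comp]
    rfl
  · change (graphRel unzip).inv.comp (diggRel (X.web × Y.web)) =
      (tensRel (diggRel X.web) (diggRel Y.web)).comp
        ((graphRel unzip).inv.comp (exclRel (graphRel unzip).inv))
    simp only [diggRel_eq, exclRel_inv_graphRel, tensRel_inv_graphRel, inv_graphRel_comp]
    congr 2
    funext P
    exact unzip_join P

theorem exclIsSymmetricMonoidal : seelyCategory.{u}.ExclIsSymmetricMonoidal :=
  ⟨exclLaxBraided, Hom.ext laxUnitRel_eq.symm, fun X Y => Hom.ext (laxMulRel_eq X.web Y.web).symm,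
    isMonoidal_der, isMonoidal_digg⟩

/-! ### The standard structure -/

/-- The objects of `seelyCategory` are the standard ones by definition, so only relations need
comparing. -/
theorem isRel_of_rel_eq {X Y : NUTS.{u}} {f : X ⟶ Y} {r : SetRel X.web Y.web} (h : f.rel = r) :
    IsRel f X Y r :=
  ⟨f, h, rfl⟩

theorem standardMultiplicatives : StandardMultiplicatives seelyCategory.{u} where
  tensorUnit := rfl
  tensorHom _ _ := isRel_of_rel_eq rfl
  associator _ _ _ := isRel_of_rel_eq rfl
  leftUnitor _ := isRel_of_rel_eq rfl
  rightUnitor _ := isRel_of_rel_eq rfl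
  braiding _ _ := isRel_of_rel_eq rfl
  ihom_obj _ _ := rfl
  ev X Y := isRel_of_rel_eq (ihom_ev_app_rel X Y)
  bot := rfl

theorem standardProducts : StandardProducts seelyCategory.{u} where
  top := rfl
  fst _ _ := isRel_of_rel_eq rfl
  snd _ _ := isRel_of_rel_eq rfl

theorem standardExponential : StandardExponential seelyCategory.{u} where
  obj _ := rfl
  map _ := isRel_of_rel_eq rfl
  der _ := isRel_of_rel_eq rfl
  digg _ := isRel_of_rel_eq rfl
  seelyUnit := isRel_of_rel_eq seelyUnitRel_eq.symm
  seelyMul _ _ := isRel_of_rel_eq seelyMulRel_eq.symm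

theorem standardDuality : StandardDuality seelyCategory.{u} :=
  ⟨dualIso, fun _ => isRel_of_rel_eq rfl, fun f => ⟨dualHom f, rfl, dualIso_natural f⟩⟩

end NUTS

theorem mainTheorem3 :
    -- the standard data on `NUTS` is the data of a Seely category
    (∃ S : SeelyCategory NUTS.{u},
      NUTS.StandardMultiplicatives S ∧ NUTS.StandardProducts S ∧ NUTS.StandardExponential S ∧
      -- `!` is a symmetric monoidal comonad with respect to `⊗`
      S.ExclIsSymmetricMonoidal ∧
      -- linear negation is the orthogonal
      NUTS.StandardDuality S) ∧
    -- the finite coproducts, dual to the finite products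
    Nonempty (Limits.IsInitial NUTS.zero.{u}) ∧ NUTS.zero.{u} = NUTS.dual NUTS.top ∧
    (∀ X Y : NUTS.{u}, ∃ (i : X ⟶ NUTS.plus X Y) (j : Y ⟶ NUTS.plus X Y),
      (NUTS.plus X Y).total = {v | (∃ w ∈ X.total, Sum.inl '' w ⊆ v) ∨
        ∃ w ∈ Y.total, Sum.inr '' w ⊆ v} ∧
      i.rel = NUTS.graphRel Sum.inl ∧ j.rel = NUTS.graphRel Sum.inr ∧
      Nonempty (Limits.IsColimit (Limits.BinaryCofan.mk i j))) :=
  ⟨⟨NUTS.seelyCategory, NUTS.standardMultiplicatives, NUTS.standardProducts,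
      NUTS.standardExponential, NUTS.exclIsSymmetricMonoidal, NUTS.standardDuality⟩,
    ⟨NUTS.zeroIsInitial⟩, NUTS.zero_eq_dual_top, fun X Y =>
      ⟨NUTS.plusInl X Y, NUTS.plusInr X Y, NUTS.plus_total X Y, rfl, rfl,
        ⟨NUTS.plusIsColimit X Y⟩⟩⟩
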